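/- Theorem 6.1 (Sergeev–Pragacz type formula for multiparameter Schur functions). Conventions. Let $\Lambda=\mathbb C[p_1,p_2,\dots]$ be the algebra of symmetric functions, let $h_k$ be given by $H(u)=1+\sum_{k\ge1}h_ku^{-k}=\exp\bigl(\sum_{k\ge1}p_k\,u^{-k}/k\bigr)$, and for $f\in\Lambda$ let $f(x_1,\dots,x_n;y_1,\dots,y_n)$ be its image under the algebra homomorphism $p_k\mapsto\sum_{i=1}^n x_i^k+(-1)^{k-1}\sum_{i=1}^n y_i^k$ into $\mathbb C[x_1,\dots,x_n,y_1,\dots,y_n]$. Let $a=(a_i)_{i\in\mathbb Z}$ be an arbitrary sequence of complex numbers. Define $h_{k;a}\in\Lambda$ for $k\ge1$ by the identity of formal series in $u^{-1}$ $$1+\sum_{k\ge1}\frac{h_{k;a}}{(u-a_1)\cdots(u-a_k)}=H(u),$$ and put $h_{0;a}=1$, $h_{k;a}=0$ for $k<0$. Put $(\tau^ra)_i=a_{i+r}$ and $\widehat a_i=-a_{1-i}$. For a Young diagram $\mu$ with row lengths $\mu_i$ and column lengths $\mu'_i$, let $d(\mu)$ be the number of its diagonal squares, and let $$s_{\mu;a}=\det\bigl[h_{\mu_i-i+j;\,\tau^{1-j}a}\bigr]_{i,j=1}^{N},$$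 where $N$ is any integer not less than the number of rows of $\mu$ (the result does not depend on $N$). Let $(k)_+=\max(k,0)$, $V(x_1,\dots,x_n)=\prod_{1\le i<k\le n}(x_i-x_k)$, and $(x\,|\,a)^m=(x-a_1)\cdots(x-a_m)$ for $m\ge1$, $(x\,|\,a)^0=1$. Statement. Let $n\ge1$ and let $\mu$ be a Young diagram with $d=d(\mu)\le n$. Then $$s_{\mu;a}(x_1,\dots,x_n;y_1,\dots,y_n)=\frac{\sum_{w\in\mathfrak S_n\times\mathfrak S_n}\varepsilon(w)\,w\bigl[f_{\mu;a}(x_1,\dots,x_n;y_1,\dots,y_n)\bigr]}{V(x_1,\dots,x_n)\,V(y_1,\dots,y_n)},$$ where $w=(w_1,w_2)$ permutes the $x$'s by $w_1$ and the $y$'s by $w_2$, $\varepsilon(w)=\operatorname{sgn}(w_1)\operatorname{sgn}(w_2)$, and $$f_{\mu;a}(x_1,\dots,x_n;y_1,\dots,y_n)=\prod_{i=1}^d (x_i\,|\,a)^{\mu_i-i}\,x_i^{(n-\mu_i)_+}\,(y_i\,|\,\widehat a)^{\mu'_i-i}\,y_i^{(n-\mu'_i)_+}\;\prod_{i=d+1}^n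 x_i^{n-i}y_i^{n-i}\;\prod_{\substack{i,j\le n\\ (i,j)\in\mu}}(x_i+y_j).$$ -/

import Mathlib

noncomputable section

namespace MultiSchur

open Finset

/-- The algebra `Λ = ℂ[p₁, p₂, …]` of symmetric functions; the variable with index `k : ℕ`
is the power sum `p_{k+1}`. -/
abbrev SymFun : Type := MvPolynomial ℕ ℂ

/-- The series `∑_{k ≥ 1} p_k t^k / k` over `Λ`. -/
def powerSumSeries : PowerSeries SymFun :=
  PowerSeries.mk fun k => match k with
    | 0 => 0
    | k + 1 => MvPolynomial.C ((k + 1 : ℂ)⁻¹) * MvPolynomial.X k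

/-- The generating series `H = 1 + ∑_{k ≥ 1} h_k t^k = exp (∑_{k ≥ 1} p_k t^k / k)` of the complete
homogeneous symmetric functions; here `t = u⁻¹`. -/
def hSeries : PowerSeries SymFun :=
  (PowerSeries.exp SymFun).subst powerSumSeries

/-- The formal series `1 / ((u - a₁) ⋯ (u - a_k))` in `t = u⁻¹`, that is,
`t^k / ((1 - a₁ t) ⋯ (1 - a_k t))`. -/
def recipSeries (a : ℤ → ℂ) (k : ℕ) : PowerSeries ℂ :=
  PowerSeries.X ^ k *
    (∏ i ∈ range k, (1 - PowerSeries.C (a ((i : ℤ) + 1)) * PowerSeries.X))⁻¹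

/-- The functions `h_{k;a}`, `k ≥ 0`, given by
`1 + ∑_{k ≥ 1} h_{k;a} / ((u - a₁) ⋯ (u - a_k)) = H(u)`. The system is unitriangular and is solved
recursively; see `coeff_hSeries`, `hNat_zero` and `hNat_unique`. -/
def hNat (a : ℤ → ℂ) (k : ℕ) : SymFun :=
  PowerSeries.coeff k hSeries -
    ∑ j : Fin k, PowerSeries.coeff k (recipSeries a j) • hNat a j
termination_by k
decreasing_by exact j.2

theorem coeff_recipSeries_self (a : ℤ → ℂ) (k : ℕ) :
    PowerSeries.coeff k (recipSeries a k) = 1 := by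
  have h := PowerSeries.coeff_X_pow_mul
    (∏ i ∈ range k, (1 - PowerSeries.C (a ((i : ℤ) + 1)) * PowerSeries.X))⁻¹ k 0
  rw [zero_add] at h
  rw [recipSeries, h, PowerSeries.coeff_zero_eq_constantCoeff_apply,
    PowerSeries.constantCoeff_inv]
  simp [map_prod]

theorem coeff_recipSeries_of_lt (a : ℤ → ℂ) {k N : ℕ} (h : N < k) :
    PowerSeries.coeff N (recipSeries a k) = 0 := by
  rw [recipSeries, PowerSeries.coeff_X_pow_mul', if_neg (by omega)]

/-- The defining expansion of `H` in the series `1 / ((u - a₁) ⋯ (u - a_k))`, in every degree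
(by `coeff_recipSeries_of_lt`, the terms with `k > N` do not contribute to degree `N`). -/
theorem coeff_hSeries (a : ℤ → ℂ) (N : ℕ) :
    PowerSeries.coeff N hSeries =
      ∑ k ∈ range (N + 1), PowerSeries.coeff N (recipSeries a k) • hNat a k := by
  rw [sum_range_succ, coeff_recipSeries_self, one_smul, hNat,
    ← Fin.sum_univ_eq_sum_range (fun k => PowerSeries.coeff N (recipSeries a k) • hNat a k) N]
  ring

/-- The expansion determines the `h_{k;a}`. -/
theorem hNat_unique (a : ℤ → ℂ) (c : ℕ → SymFun)
    (hc : ∀ N, PowerSeries.coeff N hSeries =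
      ∑ k ∈ range (N + 1), PowerSeries.coeff N (recipSeries a k) • c k) :
    c = hNat a := by
  funext k
  induction k using Nat.strong_induction_on with
  | _ N ih =>
    have h1 := hc N
    rw [coeff_hSeries a, sum_range_succ, sum_range_succ, coeff_recipSeries_self, one_smul,
      one_smul, sum_congr rfl (fun k hk => by rw [← ih k (mem_range.1 hk)])] at h1
    exact (add_left_cancel h1).symm

theorem constantCoeff_powerSumSeries : PowerSeries.constantCoeff powerSumSeries = 0 := by
  rw [← PowerSeries.coeff_zero_eq_constantCoeff_apply, powerSumSeries, PowerSeries.coeff_mk]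

theorem hasSubst_powerSumSeries : PowerSeries.HasSubst powerSumSeries :=
  PowerSeries.HasSubst.of_constantCoeff_zero' constantCoeff_powerSumSeries

/-- `h_{0;a} = 1`. -/
theorem hNat_zero (a : ℤ → ℂ) : hNat a 0 = 1 := by
  have h := PowerSeries.constantCoeff_subst_eq_zero constantCoeff_powerSumSeries
    (PowerSeries.exp SymFun - 1) (by simp)
  rw [← PowerSeries.coe_substAlgHom hasSubst_powerSumSeries, map_sub, map_one,
    PowerSeries.coe_substAlgHom] at h
  have h2 : PowerSeries.constantCoeff hSeries - 1 = 0 := by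
    rw [map_sub, map_one] at h
    exact h
  rw [hNat]
  simpa using sub_eq_zero.1 h2

/-- `h_{k;a}` for all integers `k`, with `h_{k;a} = 0` for `k < 0`. -/
def hInt (a : ℤ → ℂ) (k : ℤ) : SymFun :=
  if k < 0 then 0 else hNat a k.toNat

/-- The shifted sequence `(τ^r a)_i = a_{i+r}`. -/
def shift (r : ℤ) (a : ℤ → ℂ) : ℤ → ℂ := fun i => a (i + r)

/-- The determinant `det [h_{μ_i - i + j; τ^{1-j} a}]` of order `N`, `1 ≤ i, j ≤ N`. The indices
`i j : Fin N` start from `0`, so that `1 - j` becomes `-j`. -/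
def jacobiTrudiDet (μ : YoungDiagram) (a : ℤ → ℂ) (N : ℕ) : SymFun :=
  Matrix.det (Matrix.of fun i j : Fin N =>
    hInt (shift (-(j : ℤ)) a) ((μ.rowLen i : ℤ) - (i : ℤ) + (j : ℤ)))

/-- The multiparameter Schur function `s_{μ;a}`: the determinant above, its order being the
number `ℓ(μ)` of rows. -/
def multiSchur (μ : YoungDiagram) (a : ℤ → ℂ) : SymFun :=
  jacobiTrudiDet μ a (μ.colLen 0)

theorem rowLen_eq_zero (μ : YoungDiagram) {i : ℕ} (h : μ.colLen 0 ≤ i) : μ.rowLen i = 0 := by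
  by_contra h0
  have h1 : (i, 0) ∈ μ := YoungDiagram.mem_iff_lt_rowLen.2 (Nat.pos_of_ne_zero h0)
  have h2 := YoungDiagram.mem_iff_lt_colLen.1 h1
  omega

/-- Any order `N ≥ ℓ(μ)` gives the same determinant. -/
theorem jacobiTrudiDet_eq_multiSchur (μ : YoungDiagram) (a : ℤ → ℂ) (N : ℕ)
    (hN : μ.colLen 0 ≤ N) : jacobiTrudiDet μ a N = multiSchur μ a := by
  induction N, hN using Nat.le_induction with
  | base => rfl
  | succ N hN ih =>
    rw [← ih, jacobiTrudiDet, Matrix.det_succ_row _ (Fin.last N), Fin.sum_univ_castSucc,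
      sum_eq_zero]
    · simp [rowLen_eq_zero μ hN, hInt, hNat_zero, ← two_mul]
      rfl
    · intro j _
      have : (j : ℤ) < N := by exact_mod_cast j.2
      simp [rowLen_eq_zero μ hN, hInt, this]

/-- The polynomial ring `ℂ[x₁, …, x_n, y₁, …, y_n]`. -/
abbrev Poly (n : ℕ) : Type := MvPolynomial (Fin n ⊕ Fin n) ℂ

/-- The variable `x_{i+1}`. -/
def xv {n : ℕ} (i : Fin n) : Poly n := MvPolynomial.X (Sum.inl i)

/-- The variable `y_{i+1}`. -/
def yv {n : ℕ} (i : Fin n) : Poly n := MvPolynomial.X (Sum.inr i)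

/-- The super realization `f ↦ f(x₁, …, x_n; y₁, …, y_n)`: the algebra homomorphism sending
`p_k` to `∑ x_i^k + (-1)^{k-1} ∑ y_i^k`. -/
def superEval (n : ℕ) : SymFun →ₐ[ℂ] Poly n :=
  MvPolynomial.aeval fun k => (∑ i, xv i ^ (k + 1)) + (-1) ^ k * ∑ i, yv i ^ (k + 1)

/-- The depth `d(μ)`: the number of diagonal squares. -/
def depth (μ : YoungDiagram) : ℕ := #{c ∈ μ.cells | c.1 = c.2}

/-- The dual sequence `â_i = -a_{-i+1}`. -/
def dualSeq (a : ℤ → ℂ) : ℤ → ℂ := fun i => -a (-i + 1)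

/-- `(x | a)^m = (x - a₁) ⋯ (x - a_m)`, with `(x | a)^0 = 1`. -/
def facPow {n : ℕ} (x : Poly n) (a : ℤ → ℂ) (m : ℕ) : Poly n :=
  ∏ k ∈ range m, (x - MvPolynomial.C (a ((k : ℤ) + 1)))

/-- The polynomial `f_{μ;a}(x₁, …, x_n; y₁, …, y_n)`. The index `i : Fin n` stands for the
`(i+1)`-st row, column or variable. For `i < depth μ` we have `i + 1 ≤ μ.rowLen i, μ.colLen i`, so
`μ.rowLen i - (i + 1)` and `μ.colLen i - (i + 1)` are true differences (the Frobenius coordinates),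
while `n - μ.rowLen i` and `n - μ.colLen i` are truncated at zero on purpose. -/
def fPoly (n : ℕ) (μ : YoungDiagram) (a : ℤ → ℂ) : Poly n :=
  (∏ i ∈ univ.filter fun i : Fin n => (i : ℕ) < depth μ,
      facPow (xv i) a (μ.rowLen i - (i + 1)) * xv i ^ (n - μ.rowLen i) *
        (facPow (yv i) (dualSeq a) (μ.colLen i - (i + 1)) * yv i ^ (n - μ.colLen i))) *
    (∏ i ∈ univ.filter fun i : Fin n => depth μ ≤ (i : ℕ),
      xv i ^ (n - (i + 1)) * yv i ^ (n - (i + 1))) *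
    ∏ c : Fin n × Fin n with ((c.1 : ℕ), (c.2 : ℕ)) ∈ μ, (xv c.1 + yv c.2)

/-- The action of `w = (w₁, w₂)` on polynomials by permuting separately the `x`'s and
the `y`'s. -/
def permAct {n : ℕ} (w : Equiv.Perm (Fin n) × Equiv.Perm (Fin n)) : Poly n →ₐ[ℂ] Poly n :=
  MvPolynomial.rename (Sum.map w.1 w.2)

/-- `∑_w ε(w) w[f]`, where `ε(w) = sgn(w₁) sgn(w₂)`. -/
def antisymm {n : ℕ} (f : Poly n) : Poly n :=
  ∑ w : Equiv.Perm (Fin n) × Equiv.Perm (Fin n),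
    ((Equiv.Perm.sign w.1 * Equiv.Perm.sign w.2 : ℤˣ) : ℤ) • permAct w f

/-- `V(v₁, …, v_n) = ∏_{i < k} (v_i - v_k)`. -/
def vand {n : ℕ} (v : Fin n → Poly n) : Poly n :=
  ∏ c : Fin n × Fin n with c.1 < c.2, (v c.1 - v c.2)

theorem vand_xv_ne_zero (n : ℕ) : vand (xv (n := n)) ≠ 0 :=
  prod_ne_zero_iff.2 fun c hc => by
    have h : c.1 ≠ c.2 := (mem_filter.1 hc).2.ne
    simpa [sub_eq_zero, xv, MvPolynomial.X_inj] using h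

theorem vand_yv_ne_zero (n : ℕ) : vand (yv (n := n)) ≠ 0 :=
  prod_ne_zero_iff.2 fun c hc => by
    have h : c.1 ≠ c.2 := (mem_filter.1 hc).2.ne
    simpa [sub_eq_zero, yv, MvPolynomial.X_inj] using h

end MultiSchur

end

/-! At a point `(x; y)` put `G(u) = ∏ (u + y_j) / ∏ (u - x_i)`, expanded at infinity. With factorial
powers of arbitrary integral exponent, the value of `h_{m;b}` is the coefficient of `u⁻¹` in
`(u|b)^{m-1} G` (`evalAt_hInt`), and column operations turn `s_{μ;a}` into the determinant of the
residues of `(u|a)^{μ_i-i} u^{j-1} G` (`evalAt_jacobiTrudiDet`). This determinant, times both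
Vandermonde products, is compared with the alternating sum `altVal` by induction on the number of
variables (`evalAt_multiSchur_mul_vd`). Pass from `n` to `n + 1` variables in each group.

If `μ_1 ≤ n`, both sides are polynomials in `x_1` of degree at most `n + μ_1 ≤ 2n`. Both vanish when
`x_1` equals another `x_i`, and at `x_1 = -y_j` both reduce to `n` variables: a factor of `G`
cancels, and the alternating sum has a cancellation property of its own (`altVal_cons_cons_neg`).
These are `2n + 1` points (`altVal_eq_of_values`). If `μ'_1 ≤ n`, the same argument applies in
`y_1`.

If `μ_1` and `μ'_1` both exceed `n`, the first hook of `μ` covers the first row and column of the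
square of side `n + 1`. The alternating sum then becomes a double sum over the variables `x_k`,
`y_l` put in first place (`altVal_succ`). The determinant has the same expansion: its first row is
resolved into residues at the `x_k` (`schurDet_expand_row`), and the remaining rows are expanded
over the zeros `-y_l` of `G` (`schurDet_expand_zeros`). The terms agree by induction for the diagram
without its first hook.

The condition `d(μ) ≤ n` enters as `(n, n) ∉ μ` in zero-based indices. The interpolation argument
uses only the degrees of the factorial powers in the numerator, hence the arbitrary polynomials in
`altVal`; their explicit form matters in the hook case. -/

noncomputable section

namespace MultiSchur

/-! ### Alternating sums and Vandermonde products. -/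

section

open Finset Equiv

/-- The alternating sum `∑_w ε(w) F(z ∘ w)`. -/
def alt {n : ℕ} {α : Type*} (F : (Fin n → α) → ℂ) (z : Fin n → α) : ℂ :=
  ∑ w : Perm (Fin n), ((Perm.sign w : ℤ) : ℂ) * F (z ∘ w)

theorem sign_mul_self_cast {n : ℕ} (v : Perm (Fin n)) :
    ((Perm.sign v : ℤ) : ℂ) * ((Perm.sign v : ℤ) : ℂ) = 1 := by
  rcases Int.units_eq_one_or (Perm.sign v) with h | h <;> simp [h]

theorem alt_comp {n : ℕ} {α : Type*} (F : (Fin n → α) → ℂ) (z : Fin n → α) (v : Perm (Fin n)) :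
    alt F (z ∘ v) = ((Perm.sign v : ℤ) : ℂ) * alt F z := by
  rw [alt, alt, mul_sum, ← Equiv.sum_comp (Equiv.mulLeft v)
    (fun w => ((Perm.sign v : ℤ) : ℂ) * (((Perm.sign w : ℤ) : ℂ) * F (z ∘ w)))]
  refine sum_congr rfl fun w _ => ?_
  rw [Equiv.coe_mulLeft, Perm.sign_mul, Function.comp_assoc, ← Perm.coe_mul, Units.val_mul,
    Int.cast_mul, ← mul_assoc, ← mul_assoc, sign_mul_self_cast, one_mul]

theorem alt_of_comp {n : ℕ} {α : Type*} (F : (Fin n → α) → ℂ) (z : Fin n → α)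
    (v : Perm (Fin n)) :
    alt (fun u => F (u ∘ v)) z = ((Perm.sign v : ℤ) : ℂ) * alt F z := by
  rw [alt, alt, mul_sum, ← Equiv.sum_comp (Equiv.mulRight v)
    (fun w => ((Perm.sign v : ℤ) : ℂ) * (((Perm.sign w : ℤ) : ℂ) * F (z ∘ w)))]
  refine sum_congr rfl fun w _ => ?_
  rw [Equiv.coe_mulRight, Perm.sign_mul, Function.comp_assoc, ← Perm.coe_mul, Units.val_mul,
    Int.cast_mul, ← mul_assoc, mul_left_comm, sign_mul_self_cast, mul_one]

theorem alt_const_mul {n : ℕ} {α : Type*} (c : ℂ) (F : (Fin n → α) → ℂ) (z : Fin n → α) :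
    alt (fun u => c * F u) z = c * alt F z := by
  simp only [alt, mul_sum, mul_left_comm c]

theorem alt_eq_zero {n : ℕ} {α : Type*} (F : (Fin n → α) → ℂ) (z : Fin n → α) {i j : Fin n}
    (hij : i ≠ j) (h : z i = z j) : alt F z = 0 := by
  have h1 := alt_comp F z (swap i j)
  have h2 : z ∘ swap i j = z := by
    funext k
    rcases eq_or_ne k i with rfl | hi
    · simp [h]
    · rcases eq_or_ne k j with rfl | hj
      · simp [h]
      · simp [swap_apply_of_ne_of_ne hi hj]
  rw [h2, Perm.sign_swap hij] at h1
  simp only [Units.val_neg, Units.val_one, Int.cast_neg, Int.cast_one, neg_mul, one_mul] at h1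
  linear_combination h1 / 2

/-- Permutations are grouped by the variable they put first. `decomposeFin` lists the other
variables through a transposition; this order differs from the increasing one by a cycle, and the
two signs combine to `(-1)^k`. -/
theorem alt_succ {n : ℕ} {α : Type*} (F : (Fin (n + 1) → α) → ℂ) (z : Fin (n + 1) → α) :
    alt F z = ∑ k : Fin (n + 1), (-1 : ℂ) ^ (k : ℕ) *
      alt (fun v => F (Fin.cons (z k) v)) (z ∘ k.succAbove) := by
  rw [alt, Finset.univ_perm_fin_succ, ← Finset.univ_product_univ]
  simp only [Finset.sum_map, Equiv.toEmbedding_apply, Finset.sum_product]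
  refine Finset.sum_congr rfl fun k _ => ?_
  have key : ∀ e : Perm (Fin n), z ∘ (Perm.decomposeFin.symm (k, e)) =
      Fin.cons (z k) ((fun i : Fin n => z (swap 0 k i.succ)) ∘ e) := by
    intro e
    funext i
    refine Fin.cases ?_ (fun i => ?_) i
    · simp
    · simp [Perm.decomposeFin_symm_apply_succ]
  simp only [key, Perm.decomposeFin.symm_sign]
  refine Fin.cases ?_ (fun q => ?_) k
  · simp [alt, Function.comp_def]
  · have h2 : (fun i : Fin n => z (swap 0 q.succ i.succ)) = (z ∘ q.succ.succAbove) ∘ q.cycleRange := by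
      funext i
      simp [Fin.succAbove_cycleRange]
    rw [h2, if_neg (Fin.succ_ne_zero q)]
    have h3 := alt_comp (fun v => F (Fin.cons (z q.succ) v)) (z ∘ q.succ.succAbove) q.cycleRange
    have h4 : (-1 : ℂ) ^ (q.succ : ℕ) = -((Perm.sign q.cycleRange : ℤ) : ℂ) := by
      simp [Fin.sign_cycleRange, pow_succ]
    rw [h4, neg_mul, ← h3, alt, ← sum_neg_distrib]
    refine sum_congr rfl fun e _ => ?_
    push_cast
    ring

theorem alt_succ_insertNth {n : ℕ} {α : Type*} (p : Fin (n + 1)) (F : (Fin (n + 1) → α) → ℂ)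
    (z : Fin (n + 1) → α) :
    alt F z = ∑ k : Fin (n + 1), (-1 : ℂ) ^ ((p : ℕ) + k) *
      alt (fun v => F (p.insertNth (z k) v)) (z ∘ k.succAbove) := by
  have h1 := alt_of_comp F z p.cycleRange
  rw [alt_succ] at h1
  simp only [Fin.cons_comp_cycleRange] at h1
  have h4 : ((Perm.sign p.cycleRange : ℤ) : ℂ) = (-1 : ℂ) ^ (p : ℕ) := by
    simp [Fin.sign_cycleRange]
  rw [h4] at h1
  simp only [pow_add, mul_assoc]
  rw [← mul_sum, h1, ← mul_assoc, ← mul_pow]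
  simp

/-- The numerical value of `vand`. -/
def vd {n : ℕ} (v : Fin n → ℂ) : ℂ :=
  ∏ c : Fin n × Fin n with c.1 < c.2, (v c.1 - v c.2)

theorem vd_eq_det {n : ℕ} (v : Fin n → ℂ) : vd v = (Matrix.vandermonde (-v)).det := by
  rw [Matrix.det_vandermonde, vd, prod_filter, Fintype.prod_prod_type]
  refine prod_congr rfl fun i _ => ?_
  rw [← prod_filter]
  refine prod_congr ?_ fun j _ => ?_
  · ext j; simp
  · simp only [Pi.neg_apply]; ring

theorem vd_comp {n : ℕ} (v : Fin n → ℂ) (w : Perm (Fin n)) :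
    vd (v ∘ w) = ((Perm.sign w : ℤ) : ℂ) * vd v := by
  rw [vd_eq_det, vd_eq_det, ← Matrix.det_permute]
  rfl

theorem vd_cons {n : ℕ} (t : ℂ) (v : Fin n → ℂ) :
    vd (Fin.cons t v : Fin (n + 1) → ℂ) = (∏ i, (t - v i)) * vd v := by
  simp only [vd, prod_filter, Fintype.prod_prod_type, Fin.prod_univ_succ, Fin.cons_zero,
    Fin.cons_succ, Fin.succ_lt_succ_iff, Fin.succ_pos, if_true, if_false,
    Fin.not_lt_zero, one_mul]

theorem vd_insertNth {n : ℕ} (p : Fin (n + 1)) (t : ℂ) (v : Fin n → ℂ) :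
    vd (p.insertNth t v : Fin (n + 1) → ℂ) = (-1) ^ (p : ℕ) * (∏ i, (t - v i)) * vd v := by
  rw [← Fin.cons_comp_cycleRange, vd_comp, vd_cons, Fin.sign_cycleRange]
  push_cast
  ring

theorem vd_succAbove {n : ℕ} (p : Fin (n + 1)) (z : Fin (n + 1) → ℂ) :
    vd z = (-1) ^ (p : ℕ) * (∏ i, (z p - z (p.succAbove i))) * vd (z ∘ p.succAbove) := by
  have h := vd_insertNth p (z p) (z ∘ p.succAbove)
  rwa [show p.insertNth (z p) (z ∘ p.succAbove) = z from Fin.insertNth_self_removeNth p z] at h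

end

section

open Finset Equiv Polynomial

/-! ### Polynomial functions of one variable with a degree bound. -/

/-- `g` is a polynomial function of degree at most `D`. -/
def PolyLE (D : ℕ) (g : ℂ → ℂ) : Prop :=
  ∃ p : ℂ[X], p.natDegree ≤ D ∧ ∀ t, p.eval t = g t

namespace PolyLE

theorem const (D : ℕ) (c : ℂ) : PolyLE D fun _ => c :=
  ⟨C c, by simp, by simp⟩

theorem mono {D E : ℕ} {g : ℂ → ℂ} (h : PolyLE D g) (hDE : D ≤ E) : PolyLE E g := by
  obtain ⟨p, hp, hg⟩ := h
  exact ⟨p, hp.trans hDE, hg⟩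

theorem add {D : ℕ} {g h : ℂ → ℂ} (hg : PolyLE D g) (hh : PolyLE D h) :
    PolyLE D fun t => g t + h t := by
  obtain ⟨p, hp, hg⟩ := hg
  obtain ⟨q, hq, hh⟩ := hh
  exact ⟨p + q, natDegree_add_le_of_degree_le hp hq, fun t => by rw [eval_add, hg, hh]⟩

theorem mul {D E : ℕ} {g h : ℂ → ℂ} (hg : PolyLE D g) (hh : PolyLE E h) :
    PolyLE (D + E) fun t => g t * h t := by
  obtain ⟨p, hp, hg⟩ := hg
  obtain ⟨q, hq, hh⟩ := hh
  exact ⟨p * q, natDegree_mul_le_of_le hp hq, fun t => by rw [eval_mul, hg, hh]⟩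

theorem const_mul {D : ℕ} {g : ℂ → ℂ} (c : ℂ) (hg : PolyLE D g) :
    PolyLE D fun t => c * g t := by
  simpa using (const 0 c).mul hg

theorem sum {D : ℕ} {ι : Type*} (s : Finset ι) {g : ι → ℂ → ℂ} (hg : ∀ i ∈ s, PolyLE D (g i)) :
    PolyLE D fun t => ∑ i ∈ s, g i t := by
  classical
  induction s using Finset.induction_on with
  | empty => simpa using const D 0
  | insert i s hi ih =>
    simp only [sum_insert hi]
    exact (hg i (mem_insert_self _ _)).add (ih fun j hj => hg j (mem_insert_of_mem hj))

theorem prod {ι : Type*} (s : Finset ι) {D : ι → ℕ} {g : ι → ℂ → ℂ}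
    (hg : ∀ i ∈ s, PolyLE (D i) (g i)) : PolyLE (∑ i ∈ s, D i) fun t => ∏ i ∈ s, g i t := by
  classical
  induction s using Finset.induction_on with
  | empty => simpa using const 0 1
  | insert i s hi ih =>
    simp only [sum_insert hi, prod_insert hi]
    exact (hg i (mem_insert_self _ _)).mul (ih fun j hj => hg j (mem_insert_of_mem hj))

theorem eval (p : ℂ[X]) : PolyLE p.natDegree fun t => p.eval t := ⟨p, le_rfl, fun _ => rfl⟩

theorem comp_neg {D : ℕ} {g : ℂ → ℂ} (hg : PolyLE D g) : PolyLE D fun t => g (-t) := by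
  obtain ⟨p, hp, hg⟩ := hg
  refine ⟨p.comp (-X), ?_, fun t => by simp [hg]⟩
  rw [natDegree_comp, natDegree_neg, natDegree_X, mul_one]
  exact hp

theorem id : PolyLE 1 fun t => t := ⟨X, natDegree_X_le, by simp⟩

theorem alt {n D : ℕ} {α : Type*} {F : ℂ → (Fin n → α) → ℂ} {z : ℂ → Fin n → α}
    (h : ∀ w : Perm (Fin n), PolyLE D fun t => F t (z t ∘ w)) :
    PolyLE D fun t => MultiSchur.alt (F t) (z t) :=
  sum _ fun w _ => const_mul _ (h w)

theorem ext {D : ℕ} {g h : ℂ → ℂ} (hg : PolyLE D g) (hh : PolyLE D h) (s : Finset ℂ)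
    (hs : D < #s) (hgh : ∀ t ∈ s, g t = h t) (t : ℂ) : g t = h t := by
  obtain ⟨p, hp, hg⟩ := hg
  obtain ⟨q, hq, hh⟩ := hh
  have : p = q := eq_of_natDegree_lt_card_of_eval_eq' p q s
    (fun t ht => by rw [hg, hh, hgh t ht]) (max_lt (hp.trans_lt hs) (hq.trans_lt hs))
  rw [← hg, ← hh, this]

end PolyLE

/-! ### The alternating numerator and its degree in one variable. -/

/-- The factor of `fPoly` in the single variable `x_{i+1}` when `(x | a)^{μ_i - i}` is replaced by
an arbitrary polynomial `α i`. -/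
def weight (n : ℕ) (μ : YoungDiagram) (α : ℕ → ℂ[X]) (i : ℕ) : ℂ[X] :=
  if (i, i) ∈ μ then α i * X ^ (n - μ.rowLen i) else X ^ (n - (i + 1))

/-- The value of the analogue of `fPoly` with arbitrary polynomials `α i`, `β i` in place of the
factorial powers. -/
def fVal {n : ℕ} (μ : YoungDiagram) (α β : ℕ → ℂ[X]) (x y : Fin n → ℂ) : ℂ :=
  (∏ i : Fin n, (weight n μ α i).eval (x i)) *
    (∏ i : Fin n, (weight n μ.transpose β i).eval (y i)) *
    ∏ c : Fin n × Fin n with ((c.1 : ℕ), (c.2 : ℕ)) ∈ μ, (x c.1 + y c.2)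

/-- The alternating sum of `fVal` over both groups of variables. -/
def altVal {n : ℕ} (μ : YoungDiagram) (α β : ℕ → ℂ[X]) (x y : Fin n → ℂ) : ℂ :=
  alt (fun u => alt (fun v => fVal μ α β u v) y) x

theorem fVal_transpose {n : ℕ} (μ : YoungDiagram) (α β : ℕ → ℂ[X]) (x y : Fin n → ℂ) :
    fVal μ.transpose β α y x = fVal μ α β x y := by
  rw [fVal, fVal, YoungDiagram.transpose_transpose,
    mul_comm (∏ i : Fin n, (weight n μ.transpose β i).eval (y i))]
  congr 1
  refine prod_bij' (fun c _ => c.swap) (fun c _ => c.swap) ?_ ?_ ?_ ?_ ?_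
  · intro c hc; simpa using hc
  · intro c hc; simpa using hc
  · simp
  · simp
  · intro c _; simp [add_comm]

theorem altVal_transpose {n : ℕ} (μ : YoungDiagram) (α β : ℕ → ℂ[X]) (x y : Fin n → ℂ) :
    altVal μ.transpose β α y x = altVal μ α β x y := by
  simp only [altVal, alt, mul_sum]
  rw [sum_comm]
  refine sum_congr rfl fun w _ => sum_congr rfl fun v _ => ?_
  rw [fVal_transpose]
  ring

theorem altVal_comp_right {n : ℕ} (μ : YoungDiagram) (α β : ℕ → ℂ[X]) (x y : Fin n → ℂ)
    (w : Perm (Fin n)) :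
    altVal μ α β x (y ∘ w) = ((Perm.sign w : ℤ) : ℂ) * altVal μ α β x y := by
  rw [altVal, altVal, ← alt_const_mul]
  simp only [alt_comp]

theorem altVal_eq_zero_left {n : ℕ} (μ : YoungDiagram) (α β : ℕ → ℂ[X]) (x y : Fin n → ℂ)
    {i j : Fin n} (hij : i ≠ j) (h : x i = x j) : altVal μ α β x y = 0 :=
  alt_eq_zero _ _ hij h

theorem altVal_eq_zero_right {n : ℕ} (μ : YoungDiagram) (α β : ℕ → ℂ[X]) (x y : Fin n → ℂ)
    {i j : Fin n} (hij : i ≠ j) (h : y i = y j) : altVal μ α β x y = 0 := by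
  rw [← altVal_transpose]
  exact altVal_eq_zero_left _ _ _ _ _ hij h

/-- The degree bound satisfied by the factorial powers `(x | a)^{μ_i - i}`. -/
def DegBound (μ : YoungDiagram) (α : ℕ → ℂ[X]) : Prop :=
  ∀ i, (α i).natDegree ≤ μ.rowLen i - (i + 1)

theorem card_row_le {m : ℕ} (μ : YoungDiagram) (i : Fin m) :
    #{c : Fin m × Fin m | ((c.1 : ℕ), (c.2 : ℕ)) ∈ μ ∧ c.1 = i} ≤ min m (μ.rowLen i) := by
  have h : #{c : Fin m × Fin m | ((c.1 : ℕ), (c.2 : ℕ)) ∈ μ ∧ c.1 = i} ≤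
      #(range (min m (μ.rowLen i))) := by
    refine card_le_card_of_injOn (fun c => (c.2 : ℕ)) ?_ ?_
    · intro c hc
      simp only [coe_filter, mem_univ, true_and, Set.mem_ofPred_eq] at hc
      have := YoungDiagram.mem_iff_lt_rowLen.1 hc.1
      rw [hc.2] at this
      simpa using this
    · intro c hc c' hc' h
      simp only [coe_filter, mem_univ, true_and, Set.mem_ofPred_eq] at hc hc'
      exact Prod.ext (hc.2.trans hc'.2.symm) (Fin.ext h)
  simpa using h

/-- The minimum bounds the number of linear factors from row `i`. Since `(m - μ_i)_+ + min m μ_i =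
m`, the power of the variable makes up for the factors missing from a short row. -/
theorem natDegree_weight_add_le {m : ℕ} (μ : YoungDiagram) (α : ℕ → ℂ[X]) (hα : DegBound μ α)
    (i : Fin m) :
    (weight m μ α i).natDegree + min m (μ.rowLen i) ≤ m - (i + 1) + μ.rowLen i := by
  have hi := i.2
  rw [weight]
  split_ifs with h
  · have h1 := natDegree_mul_le_of_le (hα i) (natDegree_X_pow_le (R := ℂ) (m - μ.rowLen i))
    have h2 := YoungDiagram.mem_iff_lt_rowLen.1 h
    omega
  · have h1 := natDegree_X_pow_le (R := ℂ) (m - (i + 1))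
    omega

theorem polyLE_prod_update {m : ℕ} (p : Fin m → ℂ[X]) (c : Fin m → ℂ) (i : Fin m) :
    PolyLE (p i).natDegree fun t => ∏ k, (p k).eval (Function.update c i t k) := by
  have h := PolyLE.prod univ (D := fun k => if k = i then (p i).natDegree else 0)
    (g := fun k t => (p k).eval (Function.update c i t k)) fun k _ => ?_
  · simpa using h
  · rcases eq_or_ne k i with rfl | hk
    · simpa using PolyLE.eval (p k)
    · simpa [hk] using PolyLE.const 0 _

theorem polyLE_update {m : ℕ} (c : Fin m → ℂ) (i k : Fin m) :
    PolyLE (if k = i then 1 else 0) fun t => Function.update c i t k := by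
  rcases eq_or_ne k i with rfl | hk
  · simpa using PolyLE.id
  · simpa [hk] using PolyLE.const 0 _

theorem polyLE_fVal_left {m : ℕ} (μ : YoungDiagram) (α β : ℕ → ℂ[X]) (hα : DegBound μ α)
    (c y : Fin m → ℂ) (i : Fin m) :
    PolyLE (m - (i + 1) + μ.rowLen i) fun t => fVal μ α β (Function.update c i t) y := by
  have h1 := polyLE_prod_update (fun k : Fin m => weight m μ α k) c i
  have h2 := PolyLE.prod {c : Fin m × Fin m | ((c.1 : ℕ), (c.2 : ℕ)) ∈ μ}
    (g := fun e t => Function.update c i t e.1 + y e.2) (D := fun e => if e.1 = i then 1 else 0)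
    fun e _ => (polyLE_update c i e.1).add (PolyLE.const _ _)
  have h3 := (h1.mul (PolyLE.const 0 (∏ i : Fin m, (weight m μ.transpose β i).eval (y i)))).mul h2
  refine PolyLE.mono (g := fun t => fVal μ α β (Function.update c i t) y) h3 ?_
  rw [sum_boole, filter_filter, Nat.cast_id]
  have h4 := card_row_le μ i
  have h5 := natDegree_weight_add_le μ α hα i
  omega

/-- If `(i, j)` is a box, its factor is `t + (-t) = 0`. Otherwise `μ_i ≤ j` and `μ'_j ≤ i` in
zero-based indices, so the two one-variable bounds add up to at most `(m - 1 - i + j) + (m - 1 - j +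
i)`. -/
theorem polyLE_fVal_both {m : ℕ} (μ : YoungDiagram) (α β : ℕ → ℂ[X]) (hα : DegBound μ α)
    (hβ : DegBound μ.transpose β) (c e : Fin m → ℂ) (i j : Fin m) :
    PolyLE (2 * (m - 1)) fun t => fVal μ α β (Function.update c i t) (Function.update e j (-t)) := by
  by_cases hij : ((i : ℕ), (j : ℕ)) ∈ μ
  · have : (fun t => fVal μ α β (Function.update c i t) (Function.update e j (-t))) =
        fun _ => 0 := by
      funext t
      rw [fVal, mul_eq_zero]
      right
      refine prod_eq_zero (i := (i, j)) (by simpa using hij) ?_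
      simp
    rw [this]
    exact PolyLE.const _ _
  have h1 := polyLE_prod_update (fun k : Fin m => weight m μ α k) c i
  have h1' := (polyLE_prod_update (fun k : Fin m => weight m μ.transpose β k) e j).comp_neg
  have h2 := PolyLE.prod {c : Fin m × Fin m | ((c.1 : ℕ), (c.2 : ℕ)) ∈ μ}
    (g := fun b t => Function.update c i t b.1 + Function.update e j (-t) b.2)
    (D := fun b => (if b.1 = i then 1 else 0) + (if b.2 = j then 1 else 0))
    fun b _ => ((polyLE_update c i b.1).mono (by omega)).add
      ((polyLE_update e j b.2).comp_neg.mono (by omega))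
  have h3 := (h1.mul h1').mul h2
  refine PolyLE.mono
    (g := fun t => fVal μ α β (Function.update c i t) (Function.update e j (-t))) h3 ?_
  rw [sum_add_distrib, sum_boole, sum_boole, filter_filter, filter_filter, Nat.cast_id, Nat.cast_id]
  have h4 := card_row_le μ i
  have h5 := natDegree_weight_add_le μ α hα i
  have h4' := card_row_le μ.transpose j
  have h5' := natDegree_weight_add_le μ.transpose β hβ j
  have h6 : #{b : Fin m × Fin m | ((b.1 : ℕ), (b.2 : ℕ)) ∈ μ ∧ b.2 = j} =
      #{b : Fin m × Fin m | ((b.1 : ℕ), (b.2 : ℕ)) ∈ μ.transpose ∧ b.1 = j} :=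
    card_bij' (fun b _ => b.swap) (fun b _ => b.swap) (by simp) (by simp) (by simp) (by simp)
  rw [h6]
  have h7 : μ.rowLen i ≤ j := by
    rw [YoungDiagram.mem_iff_lt_rowLen] at hij; omega
  have h8 : μ.transpose.rowLen j ≤ i := by
    rw [YoungDiagram.rowLen_transpose]
    rw [YoungDiagram.mem_iff_lt_colLen] at hij; omega
  have := i.2
  have := j.2
  omega

theorem exists_cons_comp_perm {n : ℕ} (x : Fin n → ℂ) (w : Perm (Fin (n + 1))) :
    ∃ (c : Fin (n + 1) → ℂ) (i : Fin (n + 1)),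
      ∀ t, (Fin.cons t x : Fin (n + 1) → ℂ) ∘ w = Function.update c i t := by
  refine ⟨(Fin.cons 0 x : Fin (n + 1) → ℂ) ∘ w, w⁻¹ 0, fun t => funext fun k => ?_⟩
  rcases eq_or_ne k (w⁻¹ 0) with rfl | hk
  · simp
  · rw [Function.update_of_ne hk]
    have : w k ≠ 0 := fun h => hk (by rw [← h]; simp)
    obtain ⟨q, hq⟩ := Fin.exists_succ_eq.2 this
    simp [← hq]

theorem polyLE_altVal_cons {n : ℕ} (μ : YoungDiagram) (α β : ℕ → ℂ[X]) (hα : DegBound μ α)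
    (x : Fin n → ℂ) (y : Fin (n + 1) → ℂ) :
    PolyLE (n + μ.rowLen 0) fun t => altVal μ α β (Fin.cons t x) y := by
  refine PolyLE.alt fun w => PolyLE.alt fun v => ?_
  obtain ⟨c, i, hc⟩ := exists_cons_comp_perm x w
  simp only [hc]
  refine (polyLE_fVal_left μ α β hα _ _ _).mono ?_
  have := μ.rowLen_anti _ _ (Nat.zero_le i)
  omega

theorem polyLE_altVal_cons_cons {n : ℕ} (μ : YoungDiagram) (α β : ℕ → ℂ[X]) (hα : DegBound μ α)
    (hβ : DegBound μ.transpose β) (x y : Fin n → ℂ) :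
    PolyLE (2 * n) fun t =>
      altVal μ α β (Fin.cons t x : Fin (n + 1) → ℂ) (Fin.cons (-t) y) := by
  refine PolyLE.alt fun w => PolyLE.alt fun v => ?_
  obtain ⟨c, i, hc⟩ := exists_cons_comp_perm x w
  obtain ⟨e, j, he⟩ := exists_cons_comp_perm y v
  simp only [hc, he]
  exact (polyLE_fVal_both μ α β hα hβ c e i j).mono (by omega)

/-! ### The cancellation property of the numerator, and interpolation. -/

/-- Only the permutations that put the variable `0` in the last place survive; moving it there from
the first place costs `(-1)^n`. -/
theorem alt_cons_zero {n : ℕ} (F : (Fin (n + 1) → ℂ) → ℂ) (x : Fin n → ℂ)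
    (hF : ∀ (u : Fin n → ℂ) (t : ℂ), (∃ i, u i = 0) → F (Fin.snoc u t) = 0) :
    alt F (Fin.cons 0 x) = (-1) ^ n * alt (fun u => F (Fin.snoc u 0)) x := by
  rw [alt_succ_insertNth (Fin.last n), Fin.sum_univ_succ, sum_eq_zero, add_zero]
  · simp [Fin.insertNth_last', Function.comp_def]
  · intro k _
    rw [alt, sum_eq_zero, mul_zero]
    intro w _
    rw [Fin.insertNth_last', hF, mul_zero]
    obtain ⟨i, hi⟩ := Fin.exists_succAbove_eq (Fin.succ_ne_zero k).symm
    exact ⟨w⁻¹ i, by simp [hi]⟩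

theorem eval_weight_zero {m : ℕ} (μ : YoungDiagram) (α : ℕ → ℂ[X]) {i : ℕ} (hi : i + 1 < m)
    (hμ : μ.rowLen i < m) : (weight m μ α i).eval 0 = 0 := by
  rw [weight]
  split_ifs
  · rw [eval_mul, eval_pow, eval_X, zero_pow (by omega), mul_zero]
  · rw [eval_pow, eval_X, zero_pow (by omega)]

theorem eval_weight_succ {n : ℕ} (μ : YoungDiagram) (α : ℕ → ℂ[X]) {i : ℕ} (hi : i < n)
    (hμ : μ.rowLen i ≤ n) (t : ℂ) :
    (weight (n + 1) μ α i).eval t = (weight n μ α i).eval t * t := by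
  rw [weight, weight]
  split_ifs
  · rw [Nat.succ_sub hμ, pow_succ]; simp [mul_assoc]
  · rw [show n + 1 - (i + 1) = n - (i + 1) + 1 by omega, pow_succ]; simp

theorem fVal_snoc_eq_zero_left {n : ℕ} (μ : YoungDiagram) (α β : ℕ → ℂ[X])
    (hμ : μ.rowLen 0 ≤ n) (u : Fin n → ℂ) (t : ℂ) (v : Fin (n + 1) → ℂ) (h : ∃ i, u i = 0) :
    fVal μ α β (Fin.snoc u t) v = 0 := by
  obtain ⟨i, hi⟩ := h
  rw [fVal, prod_eq_zero (i := i.castSucc) (mem_univ _), zero_mul, zero_mul]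
  have := μ.rowLen_anti _ _ (Nat.zero_le i)
  rw [Fin.snoc_castSucc, hi, eval_weight_zero] <;> simp
  omega

/-- Columns may be longer than `n`, and then the weight need not contain a power of `v j`. In that
case the box `(n, j)` contributes `0 + v j`, because the last `x` is already zero. -/
theorem fVal_snoc_eq_zero_right {n : ℕ} (μ : YoungDiagram) (α β : ℕ → ℂ[X])
    (u v : Fin n → ℂ) (t : ℂ) (h : ∃ i, v i = 0) :
    fVal μ α β (Fin.snoc u 0 : Fin (n + 1) → ℂ) (Fin.snoc v t) = 0 := by
  obtain ⟨j, hj⟩ := h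
  rw [fVal]
  by_cases h : (n, (j : ℕ)) ∈ μ
  · rw [mul_eq_zero]
    right
    refine prod_eq_zero (i := (Fin.last n, j.castSucc)) (by simpa using h) ?_
    simp [hj]
  · rw [prod_eq_zero (f := fun i : Fin (n + 1) => (weight (n + 1) μ.transpose β i).eval _)
      (i := j.castSucc) (mem_univ _), mul_zero, zero_mul]
    rw [YoungDiagram.mem_iff_lt_colLen] at h
    rw [Fin.snoc_castSucc, hj, eval_weight_zero] <;> simp
    omega

/-- One more variable raises every monomial exponent by one, except in a column longer than `n`,
where the exponent is zero before and after. There the missing factor `v j` comes from the box `(n,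
j)`; this trade is `h2`. -/
theorem fVal_snoc_zero {n : ℕ} (μ : YoungDiagram) (α β : ℕ → ℂ[X])
    (hμ : μ.rowLen 0 ≤ n) (u v : Fin n → ℂ) :
    fVal μ α β (Fin.snoc u 0 : Fin (n + 1) → ℂ) (Fin.snoc v 0) =
      (∏ i, u i) * (∏ j, v j) * fVal μ α β u v := by
  have hnn : (n, n) ∉ μ := fun h => by
    have := YoungDiagram.mem_iff_lt_rowLen.1 h
    have := μ.rowLen_anti _ _ (Nat.zero_le n)
    omega
  have hin : ∀ i : ℕ, (i, n) ∉ μ := fun i h => by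
    have := YoungDiagram.mem_iff_lt_rowLen.1 h
    have := μ.rowLen_anti _ _ (Nat.zero_le i)
    omega
  have h1 : ∏ i : Fin (n + 1), (weight (n + 1) μ α i).eval ((Fin.snoc u 0 : Fin (n + 1) → ℂ) i) =
      (∏ i : Fin n, (weight n μ α i).eval (u i)) * ∏ i, u i := by
    rw [Fin.prod_univ_castSucc, ← prod_mul_distrib]
    simp only [Fin.snoc_castSucc, Fin.snoc_last, Fin.val_last, Fin.val_castSucc]
    have : (weight (n + 1) μ α n).eval 0 = 1 := by simp [weight, hnn]
    rw [this, mul_one]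
    refine prod_congr rfl fun i _ => eval_weight_succ _ _ i.2 ?_ _
    have := μ.rowLen_anti _ _ (Nat.zero_le i)
    omega
  have h2 : (∏ i : Fin (n + 1), (weight (n + 1) μ.transpose β i).eval
        ((Fin.snoc v 0 : Fin (n + 1) → ℂ) i)) *
      ∏ j : Fin n, (if (n, (j : ℕ)) ∈ μ then v j else 1) =
      (∏ i : Fin n, (weight n μ.transpose β i).eval (v i)) * ∏ i, v i := by
    rw [Fin.prod_univ_castSucc, ← prod_mul_distrib]
    simp only [Fin.snoc_castSucc, Fin.snoc_last, Fin.val_last, Fin.val_castSucc]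
    have : (weight (n + 1) μ.transpose β n).eval 0 = 1 := by simp [weight, hnn]
    rw [this, mul_one, ← prod_mul_distrib]
    refine prod_congr rfl fun j _ => ?_
    split_ifs with h
    · have h3 := YoungDiagram.mem_iff_lt_colLen.1 h
      have h4 : ((j : ℕ), (j : ℕ)) ∈ μ := μ.up_left_mem j.2.le le_rfl h
      simp [weight, h4, show n + 1 - μ.colLen j = 0 by omega, show n - μ.colLen j = 0 by omega]
    · rw [mul_one]
      refine eval_weight_succ _ _ j.2 ?_ _
      rw [YoungDiagram.mem_iff_lt_colLen] at h
      simpa using h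
  have h3 : ∏ c : Fin (n + 1) × Fin (n + 1) with ((c.1 : ℕ), (c.2 : ℕ)) ∈ μ,
        ((Fin.snoc u 0 : Fin (n + 1) → ℂ) c.1 + (Fin.snoc v 0 : Fin (n + 1) → ℂ) c.2) =
      (∏ c : Fin n × Fin n with ((c.1 : ℕ), (c.2 : ℕ)) ∈ μ, (u c.1 + v c.2)) *
        ∏ j : Fin n, (if (n, (j : ℕ)) ∈ μ then v j else 1) := by
    simp [prod_filter, Fintype.prod_prod_type, Fin.prod_univ_castSucc, hin]
  rw [fVal, h1, h3, fVal]
  linear_combination (∏ i : Fin n, (weight n μ α i).eval (u i)) * (∏ i, u i) *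
    (∏ c : Fin n × Fin n with ((c.1 : ℕ), (c.2 : ℕ)) ∈ μ, (u c.1 + v c.2)) * h2

theorem altVal_cons_zero {n : ℕ} (μ : YoungDiagram) (α β : ℕ → ℂ[X])
    (hμ : μ.rowLen 0 ≤ n) (x y : Fin n → ℂ) :
    altVal μ α β (Fin.cons 0 x : Fin (n + 1) → ℂ) (Fin.cons 0 y) =
      (∏ i, x i) * (∏ j, y j) * altVal μ α β x y := by
  rw [altVal, alt_cons_zero]
  · have h1 : ∀ u : Fin n → ℂ,
        alt (fun v => fVal μ α β (Fin.snoc u 0 : Fin (n + 1) → ℂ) v) (Fin.cons 0 y) =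
        (-1) ^ n * ((∏ i, u i) * ((∏ j, y j) * alt (fun v => fVal μ α β u v) y)) := by
      intro u
      rw [alt_cons_zero _ _ fun v t h => fVal_snoc_eq_zero_right μ α β u v t h]
      simp only [fVal_snoc_zero μ α β hμ, mul_assoc, alt_const_mul]
      congr 2
      rw [alt, alt, mul_sum]
      refine sum_congr rfl fun w _ => ?_
      rw [show ∏ j, (y ∘ w) j = ∏ j, y j from Equiv.prod_comp w y]
      ring
    simp only [h1, alt_const_mul]
    rw [← mul_assoc, ← mul_pow, neg_one_mul, neg_neg, one_pow, one_mul, altVal, alt, alt, mul_sum]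
    refine sum_congr rfl fun w _ => ?_
    rw [show ∏ j, (x ∘ w) j = ∏ j, x j from Equiv.prod_comp w x]
    ring
  · intro u t h
    rw [alt, sum_eq_zero]
    intro w _
    rw [fVal_snoc_eq_zero_left μ α β hμ u t _ h, mul_zero]

/-- The points at which all denominators that occur are nonzero. -/
structure Generic {m n : ℕ} (x : Fin m → ℂ) (y : Fin n → ℂ) : Prop where
  inj_left : Function.Injective x
  inj_right : Function.Injective y
  ne_left : ∀ i, x i ≠ 0
  ne_right : ∀ j, y j ≠ 0
  add_ne : ∀ i j, x i + y j ≠ 0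

namespace Generic

theorem symm {m n : ℕ} {x : Fin m → ℂ} {y : Fin n → ℂ} (h : Generic x y) : Generic y x :=
  ⟨h.2, h.1, h.4, h.3, fun i j => by rw [add_comm]; exact h.5 j i⟩

theorem comp {m n p q : ℕ} {x : Fin m → ℂ} {y : Fin n → ℂ} (h : Generic x y)
    {f : Fin p → Fin m} {g : Fin q → Fin n} (hf : Function.Injective f)
    (hg : Function.Injective g) : Generic (x ∘ f) (y ∘ g) :=
  ⟨h.1.comp hf, h.2.comp hg, fun _ => h.3 _, fun _ => h.4 _, fun _ _ => h.5 _ _⟩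

theorem comp_left {m n p : ℕ} {x : Fin m → ℂ} {y : Fin n → ℂ} (h : Generic x y)
    {f : Fin p → Fin m} (hf : Function.Injective f) : Generic (x ∘ f) y :=
  h.comp hf Function.injective_id

/-- The points `x_i` and `-y_j`. -/
def points {m n : ℕ} (x : Fin m → ℂ) (y : Fin n → ℂ) : Finset ℂ :=
  univ.image x ∪ univ.image (-y)

theorem card_points {m n : ℕ} {x : Fin m → ℂ} {y : Fin n → ℂ} (h : Generic x y) :
    #(points x y) = m + n := by
  rw [points, card_union_of_disjoint, card_image_of_injective _ h.1,
    card_image_of_injective _ (show Function.Injective (-y) from neg_injective.comp h.2)]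
  · simp
  · rw [disjoint_left]
    intro a ha hb
    simp only [mem_image, mem_univ, true_and, Pi.neg_apply] at ha hb
    obtain ⟨i, rfl⟩ := ha
    obtain ⟨j, hj⟩ := hb
    exact h.5 i j (by rw [← hj]; ring)

end Generic

/-- Both sides have degree at most `2n` in `t`. They vanish at the `2n` points `x_i` and `-y_j`,
where two arguments in one group coincide, and they agree at `t = 0` by `altVal_cons_zero`.
Genericity makes these points distinct. -/
theorem altVal_cons_cons_neg {n : ℕ} (μ : YoungDiagram) (α β : ℕ → ℂ[X]) (hα : DegBound μ α)
    (hβ : DegBound μ.transpose β) (hμ : μ.rowLen 0 ≤ n) {x y : Fin n → ℂ} (h : Generic x y)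
    (t : ℂ) :
    altVal μ α β (Fin.cons t x : Fin (n + 1) → ℂ) (Fin.cons (-t) y) =
      (∏ i, (x i - t)) * (∏ j, (y j + t)) * altVal μ α β x y := by
  have hp := PolyLE.prod univ (D := fun _ => 1) (g := fun i t => x i - t) fun i _ =>
    ⟨C (x i) - X, by simpa using natDegree_sub_le (C (x i)) (X : ℂ[X]), by simp⟩
  have hq := PolyLE.prod univ (D := fun _ => 1) (g := fun i t => y i + t) fun i _ =>
    (PolyLE.const 1 (y i)).add PolyLE.id
  have hr : PolyLE (2 * n) fun t => (∏ i, (x i - t)) * (∏ j, (y j + t)) * altVal μ α β x y :=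
    ((hp.mul hq).mul (PolyLE.const 0 _)).mono (by simp; omega)
  refine (polyLE_altVal_cons_cons μ α β hα hβ x y).ext hr (insert 0 (Generic.points x y)) ?_ ?_ t
  · rw [card_insert_of_notMem, h.card_points]
    · omega
    · simp only [Generic.points, mem_union, mem_image, mem_univ, true_and, not_or, not_exists,
        Pi.neg_apply, neg_eq_zero]
      exact ⟨h.3, h.4⟩
  · intro s hs
    rw [mem_insert, Generic.points, mem_union, mem_image, mem_image] at hs
    rcases hs with rfl | ⟨i, _, rfl⟩ | ⟨j, _, rfl⟩
    · simp [altVal_cons_zero μ α β hμ x y]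
    · rw [prod_eq_zero (mem_univ i) (sub_self _), zero_mul, zero_mul]
      exact altVal_eq_zero_left _ _ _ _ _ (Fin.succ_ne_zero i) (by simp)
    · rw [prod_eq_zero (f := fun k => y k + (-y) j) (mem_univ j) (by simp), mul_zero, zero_mul]
      exact altVal_eq_zero_right _ _ _ _ _ (Fin.succ_ne_zero j) (by simp)

theorem altVal_insertNth_right {n : ℕ} (μ : YoungDiagram) (α β : ℕ → ℂ[X])
    (x : Fin (n + 1) → ℂ) (y : Fin n → ℂ) (t : ℂ) (j : Fin (n + 1)) :
    altVal μ α β x (j.insertNth t y) = (-1) ^ (j : ℕ) * altVal μ α β x (Fin.cons t y) := by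
  rw [← Fin.cons_comp_cycleRange, altVal_comp_right, Fin.sign_cycleRange]
  simp

/-- A polynomial function of `x₁` of degree at most `μ₁ ≤ n` that has the right values at the points
`-y_j` agrees with the quotient of alternating sums. -/
theorem altVal_eq_of_values {n : ℕ} (μ : YoungDiagram) (α β : ℕ → ℂ[X]) (hα : DegBound μ α)
    (hβ : DegBound μ.transpose β) (hμ : μ.rowLen 0 ≤ n) {x : Fin n → ℂ} {y : Fin (n + 1) → ℂ}
    (h : Generic x y) {s : ℂ → ℂ} (hs : PolyLE (μ.rowLen 0) s)
    (hsy : ∀ j, s (-y j) * (vd x * vd (y ∘ j.succAbove)) = altVal μ α β x (y ∘ j.succAbove))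
    (t : ℂ) :
    s t * (vd (Fin.cons t x : Fin (n + 1) → ℂ) * vd y) = altVal μ α β (Fin.cons t x) y := by
  have hp := PolyLE.prod univ (D := fun _ => 1) (g := fun i t => t - x i) fun i _ =>
    ⟨X - C (x i), by simp, by simp⟩
  have hl : PolyLE (n + μ.rowLen 0) fun t =>
      s t * (vd (Fin.cons t x : Fin (n + 1) → ℂ) * vd y) := by
    simp only [vd_cons]
    exact (hs.mul ((hp.mul (PolyLE.const 0 _)).mul (PolyLE.const 0 _))).mono (by simp; omega)
  refine hl.ext (polyLE_altVal_cons μ α β hα x y) (Generic.points x y) ?_ ?_ t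
  -- There are `n` points `x_i` and `n + 1` points `-y_j`, one more than `2n ≥ n + μ_1`.
  · rw [h.card_points]; omega
  · intro r hr
    rw [Generic.points, mem_union, mem_image, mem_image] at hr
    rcases hr with ⟨i, _, rfl⟩ | ⟨j, _, rfl⟩
    · rw [vd_cons, prod_eq_zero (mem_univ i) (sub_self _), zero_mul, zero_mul, mul_zero]
      exact (altVal_eq_zero_left _ _ _ _ _ (Fin.succ_ne_zero i) (by simp)).symm
    -- Bringing `y j` to the front costs `(-1)^j`, the sign that `vd_succAbove` produces on the
    -- other side.
    · have h1 : altVal μ α β (Fin.cons (-y j) x) y =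
          (-1) ^ (j : ℕ) * altVal μ α β (Fin.cons (-y j) x) (Fin.cons (y j) (y ∘ j.succAbove)) := by
        rw [← altVal_insertNth_right]
        congr 1
        exact (Fin.insertNth_self_removeNth j y).symm
      have h2 := altVal_cons_cons_neg μ α β hα hβ hμ
        (h.symm.comp_left j.succAbove_right_injective).symm (-y j)
      rw [neg_neg] at h2
      have h3 : ∏ i, (-y j - x i) = (-1) ^ n * ∏ i, (x i + y j) := by
        rw [← Fin.prod_const, ← prod_mul_distrib]
        exact prod_congr rfl fun i _ => by ring
      have h4 : ∏ i, (y j - y (j.succAbove i)) = (-1) ^ n * ∏ i, (y (j.succAbove i) - y j) := by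
        rw [← Fin.prod_const, ← prod_mul_distrib]
        exact prod_congr rfl fun i _ => by ring
      have h5 : ((-1 : ℂ) ^ n) * (-1) ^ n = 1 := by rw [← mul_pow]; simp
      rw [Pi.neg_apply, h1, h2, vd_cons, vd_succAbove j y, ← hsy j, h3, h4]
      simp only [Function.comp_apply, sub_neg_eq_add, ← sub_eq_add_neg]
      linear_combination (s (-y j) * (∏ i, (x i + y j)) * (∏ i, (y (j.succAbove i) - y j)) *
        vd x * vd (y ∘ j.succAbove) * (-1) ^ (j : ℕ)) * h5

/-! ### Removal of the first hook. -/

/-- The diagram obtained by removing the first row and the first column. -/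
def removeHook (μ : YoungDiagram) : YoungDiagram where
  cells := (μ.cells.filter fun c => c.1 ≠ 0 ∧ c.2 ≠ 0).image fun c => (c.1 - 1, c.2 - 1)
  isLowerSet := by
    intro a b hab ha
    simp only [coe_image, coe_filter, Set.mem_image, Set.mem_ofPred_eq] at ha ⊢
    obtain ⟨c, ⟨hc, h1, h2⟩, rfl⟩ := ha
    refine ⟨(b.1 + 1, b.2 + 1), ⟨?_, by simp⟩, by simp⟩
    have h3 : b.1 ≤ c.1 - 1 := hab.1
    have h4 : b.2 ≤ c.2 - 1 := hab.2
    exact μ.up_left_mem (i2 := c.1) (j2 := c.2) (by omega) (by omega) hc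

theorem mem_removeHook {μ : YoungDiagram} {i j : ℕ} :
    (i, j) ∈ removeHook μ ↔ (i + 1, j + 1) ∈ μ := by
  rw [← YoungDiagram.mem_cells, removeHook]
  simp only [mem_image, mem_filter, YoungDiagram.mem_cells, Prod.mk.injEq]
  constructor
  · rintro ⟨c, ⟨hc, h1, h2⟩, h3, h4⟩
    rwa [show (i + 1, j + 1) = c from Prod.ext (by simp; omega) (by simp; omega)]
  · intro h
    exact ⟨(i + 1, j + 1), ⟨h, by simp⟩, by simp⟩

theorem rowLen_removeHook (μ : YoungDiagram) (i : ℕ) :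
    (removeHook μ).rowLen i = μ.rowLen (i + 1) - 1 := by
  refine eq_of_forall_lt_iff fun j => ?_
  rw [← YoungDiagram.mem_iff_lt_rowLen, mem_removeHook, YoungDiagram.mem_iff_lt_rowLen]
  omega

theorem transpose_removeHook (μ : YoungDiagram) :
    (removeHook μ).transpose = removeHook μ.transpose := by
  ext ⟨i, j⟩
  simp [mem_removeHook]

theorem colLen_removeHook (μ : YoungDiagram) (j : ℕ) :
    (removeHook μ).colLen j = μ.colLen (j + 1) - 1 := by
  rw [← YoungDiagram.rowLen_transpose, transpose_removeHook, rowLen_removeHook,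
    YoungDiagram.rowLen_transpose]

theorem weight_succ_succ {n : ℕ} (μ : YoungDiagram) (α : ℕ → ℂ[X]) {i : ℕ} :
    weight (n + 1) μ α (i + 1) = weight n (removeHook μ) (fun k => α (k + 1)) i := by
  simp only [weight, mem_removeHook, rowLen_removeHook]
  split_ifs with h
  · have := YoungDiagram.mem_iff_lt_rowLen.1 h
    congr 2
    omega
  · congr 1
    omega

theorem weight_zero {n : ℕ} (μ : YoungDiagram) (α : ℕ → ℂ[X]) (h : n < μ.rowLen 0) :
    weight (n + 1) μ α 0 = α 0 := by
  have h1 : (0, 0) ∈ μ := YoungDiagram.mem_iff_lt_rowLen.2 (by omega)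
  rw [weight, if_pos h1, Nat.sub_eq_zero_of_le h, pow_zero, mul_one]

/-- The first row and column of the square lie in `μ`, so the first variables carry no monomial
factor, and the hook contributes every linear factor that involves `s` or `t`. -/
theorem fVal_cons {n : ℕ} (μ : YoungDiagram) (α β : ℕ → ℂ[X]) (h : n < μ.rowLen 0)
    (h' : n < μ.colLen 0) (s t : ℂ) (u v : Fin n → ℂ) :
    fVal μ α β (Fin.cons s u : Fin (n + 1) → ℂ) (Fin.cons t v) =
      (α 0).eval s * (β 0).eval t * (s + t) * (∏ j, (s + v j)) * (∏ i, (u i + t)) *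
        fVal (removeHook μ) (fun k => α (k + 1)) (fun k => β (k + 1)) u v := by
  have h1 : ∀ i : Fin (n + 1), (0, (i : ℕ)) ∈ μ := fun i =>
    YoungDiagram.mem_iff_lt_rowLen.2 (by have := i.2; omega)
  have h2 : ∀ i : Fin (n + 1), ((i : ℕ), 0) ∈ μ := fun i =>
    YoungDiagram.mem_iff_lt_colLen.2 (by have := i.2; omega)
  have h3 : (0, 0) ∈ μ := h1 0
  have h4 : ∀ i : Fin n, (0, (i : ℕ) + 1) ∈ μ := fun i => h1 i.succ
  have h5 : ∀ i : Fin n, ((i : ℕ) + 1, 0) ∈ μ := fun i => h2 i.succ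
  have hbox : ∏ c : Fin (n + 1) × Fin (n + 1) with ((c.1 : ℕ), (c.2 : ℕ)) ∈ μ,
        ((Fin.cons s u : Fin (n + 1) → ℂ) c.1 + (Fin.cons t v : Fin (n + 1) → ℂ) c.2) =
      (s + t) * (∏ j, (s + v j)) * ((∏ i, (u i + t)) *
        ∏ c : Fin n × Fin n with ((c.1 : ℕ), (c.2 : ℕ)) ∈ removeHook μ, (u c.1 + v c.2)) := by
    simp only [prod_filter, Fintype.prod_prod_type, Fin.prod_univ_succ, Fin.cons_zero,
      Fin.cons_succ, Fin.val_zero, Fin.val_succ, h3, h4, h5, if_true, mem_removeHook,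
      prod_mul_distrib]
    ring
  rw [fVal, hbox, Fin.prod_univ_succ, Fin.prod_univ_succ, fVal, transpose_removeHook]
  simp only [Fin.cons_zero, Fin.cons_succ, Fin.val_zero, Fin.val_succ, weight_succ_succ]
  rw [weight_zero μ α h, weight_zero μ.transpose β (by simpa using h')]
  ring

/-- Once `x k` and `y l` stand first, the hook factors are symmetric in the remaining variables and
leave the inner alternating sums. -/
theorem altVal_succ {n : ℕ} (μ : YoungDiagram) (α β : ℕ → ℂ[X]) (h : n < μ.rowLen 0)
    (h' : n < μ.colLen 0) (x y : Fin (n + 1) → ℂ) :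
    altVal μ α β x y = ∑ k : Fin (n + 1), ∑ l : Fin (n + 1), (-1) ^ (k : ℕ) * (-1) ^ (l : ℕ) *
      ((α 0).eval (x k) * (β 0).eval (y l) * (∏ j, (x k + y j)) *
        (∏ i, (x (k.succAbove i) + y l)) *
        altVal (removeHook μ) (fun i => α (i + 1)) (fun i => β (i + 1)) (x ∘ k.succAbove)
          (y ∘ l.succAbove)) := by
  have hp : ∀ {m : ℕ} (s : ℂ) (z : Fin m → ℂ) (w : Perm (Fin m)),
      ∏ j, (s + (z ∘ w) j) = ∏ j, (s + z j) := fun s z w =>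
    Equiv.prod_comp w fun j => s + z j
  have hq : ∀ {m : ℕ} (s : ℂ) (z : Fin m → ℂ) (w : Perm (Fin m)),
      ∏ j, ((z ∘ w) j + s) = ∏ j, (z j + s) := fun s z w =>
    Equiv.prod_comp w fun j => z j + s
  rw [altVal, alt_succ]
  refine sum_congr rfl fun k _ => ?_
  have h1 : ∀ u : Fin n → ℂ, alt (fun v => fVal μ α β (Fin.cons (x k) u) v) y =
      ∑ l : Fin (n + 1), (-1) ^ (l : ℕ) * ((α 0).eval (x k) * (β 0).eval (y l) * (∏ j, (x k + y j)) *
        ((∏ i, (u i + y l)) * alt (fun v => fVal (removeHook μ) (fun i => α (i + 1))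
          (fun i => β (i + 1)) u v) (y ∘ l.succAbove))) := by
    intro u
    rw [alt_succ]
    refine sum_congr rfl fun l _ => ?_
    rw [Fin.prod_univ_succAbove _ l]
    congr 1
    simp only [fVal_cons μ α β h h']
    rw [alt, alt, mul_sum, mul_sum]
    refine sum_congr rfl fun w _ => ?_
    rw [hp]
    simp only [Function.comp_apply]
    ring
  simp only [h1]
  simp only [alt, mul_sum, altVal]
  rw [sum_comm]
  refine sum_congr rfl fun l _ => sum_congr rfl fun w _ => ?_
  refine sum_congr rfl fun v _ => ?_
  rw [hq]
  simp only [Function.comp_apply]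
  ring

/-! ### Residues at infinity and partial fractions. -/

/-- The variable `u = t⁻¹` in the field of Laurent series in `t`. -/
def uL : LaurentSeries ℂ := HahnSeries.single (-1) 1

/-- The coefficient of `u⁻¹`. -/
def res : LaurentSeries ℂ →+ ℂ where
  toFun f := f.coeff 1
  map_zero' := rfl
  map_add' _ _ := rfl

theorem res_apply (f : LaurentSeries ℂ) : res f = f.coeff 1 := rfl

/-- The inclusion of the polynomials in `u`. -/
def toL : ℂ[X] →+* LaurentSeries ℂ := eval₂RingHom HahnSeries.C uL

theorem toL_C (c : ℂ) : toL (C c) = HahnSeries.C c := by simp [toL]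

theorem toL_X : toL X = uL := by simp [toL]

theorem res_C_mul (c : ℂ) (f : LaurentSeries ℂ) : res (toL (C c) * f) = c * res f := by
  rw [toL_C]
  exact HahnSeries.coeff_single_zero_mul

/-- The linear factor `u - x`. -/
def lin (x : ℂ) : LaurentSeries ℂ := toL (X - C x)

/-- Laurent series of the form `t^z (1 + O(t))`. -/
def MonicOrder (z : ℤ) (f : LaurentSeries ℂ) : Prop :=
  ∃ g : PowerSeries ℂ, PowerSeries.constantCoeff g = 1 ∧
    f = HahnSeries.single z 1 * (g : LaurentSeries ℂ)

namespace MonicOrder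

theorem one : MonicOrder 0 1 := ⟨1, by simp, by simp⟩

theorem mul {z w : ℤ} {f g : LaurentSeries ℂ} (hf : MonicOrder z f) (hg : MonicOrder w g) :
    MonicOrder (z + w) (f * g) := by
  obtain ⟨p, hp, rfl⟩ := hf
  obtain ⟨q, hq, rfl⟩ := hg
  refine ⟨p * q, by simp [hp, hq], ?_⟩
  rw [PowerSeries.coe_mul, mul_mul_mul_comm, HahnSeries.single_mul_single, one_mul]

theorem ne_zero {z : ℤ} {f : LaurentSeries ℂ} (hf : MonicOrder z f) : f ≠ 0 := by
  obtain ⟨p, hp, rfl⟩ := hf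
  refine mul_ne_zero (by simp) ?_
  rw [Ne, ← PowerSeries.coe_zero, HahnSeries.ofPowerSeries_injective.eq_iff]
  rintro rfl
  simp at hp

theorem inv {z : ℤ} {f : LaurentSeries ℂ} (hf : MonicOrder z f) : MonicOrder (-z) f⁻¹ := by
  have h0 := hf.ne_zero
  obtain ⟨p, hp, hf⟩ := hf
  refine ⟨p⁻¹, by simp [hp], ?_⟩
  refine (eq_inv_of_mul_eq_one_left ?_).symm
  rw [hf, mul_comm, mul_mul_mul_comm, HahnSeries.single_mul_single, ← PowerSeries.coe_mul,
    PowerSeries.mul_inv_cancel _ (by simp [hp])]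
  simp

theorem lin (x : ℂ) : MonicOrder (-1) (lin x) := by
  refine ⟨1 - PowerSeries.C x * PowerSeries.X, by simp, ?_⟩
  rw [PowerSeries.coe_sub, PowerSeries.coe_mul, PowerSeries.coe_X, PowerSeries.coe_C,
    PowerSeries.coe_one, mul_sub, mul_one, mul_left_comm, HahnSeries.single_mul_single]
  simp [MultiSchur.lin, toL, uL, HahnSeries.C_apply]

theorem res_mul {z : ℤ} {f : LaurentSeries ℂ} (hf : MonicOrder z f) (hz : 1 < z)
    (g : PowerSeries ℂ) : res (f * g) = 0 := by
  obtain ⟨p, hp, rfl⟩ := hf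
  rw [mul_assoc, ← PowerSeries.coe_mul, res_apply, HahnSeries.coeff_single_mul, PowerSeries.coeff_coe, if_pos (by omega), mul_zero]

theorem res_eq_one {f : LaurentSeries ℂ} (hf : MonicOrder 1 f) : res f = 1 := by
  obtain ⟨p, hp, rfl⟩ := hf
  rw [res_apply, HahnSeries.coeff_single_mul, PowerSeries.coeff_coe]
  simpa using hp

end MonicOrder

theorem lin_ne_zero (x : ℂ) : lin x ≠ 0 := (MonicOrder.lin x).ne_zero

theorem res_toL (p : ℂ[X]) : res (toL p) = 0 := by
  induction p using Polynomial.induction_on' with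
  | add p q hp hq => rw [map_add, map_add, hp, hq, add_zero]
  | monomial n c =>
    rw [← C_mul_X_pow_eq_monomial, map_mul, res_C_mul, map_pow, toL_X]
    change c * (uL ^ n).coeff 1 = 0
    rw [uL, HahnSeries.single_pow, HahnSeries.coeff_single_of_ne, mul_zero]
    simp
    omega

theorem res_toL_mul_inv (p : ℂ[X]) (x : ℂ) : res (toL p * (lin x)⁻¹) = p.eval x := by
  have h := congrArg toL (EuclideanDomain.div_add_mod p (X - C x))
  rw [Polynomial.mod_X_sub_C_eq_C_eval, map_add, map_mul] at h
  change lin x * _ + _ = _ at h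
  rw [← h, add_mul, mul_right_comm, mul_inv_cancel₀ (lin_ne_zero x), one_mul, map_add, res_toL,
    zero_add, res_C_mul, (MonicOrder.lin x).inv.res_eq_one, mul_one]

/-- Partial fractions with simple poles at `x_0, …, x_n`. -/
theorem partial_fractions {n : ℕ} (q : ℂ[X]) {x : Fin (n + 1) → ℂ} (hx : Function.Injective x) :
    toL q * ∏ i, (lin (x i))⁻¹ =
      toL (q /ₘ ∏ i, (X - C (x i))) +
        ∑ k, toL (C (q.eval (x k) / ∏ i, (x k - x (k.succAbove i)))) * (lin (x k))⁻¹ := by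
  set P : ℂ[X] := ∏ i, (X - C (x i)) with hP
  have hPm : P.Monic := monic_prod_of_monic _ _ fun i _ => monic_X_sub_C _
  have hPd : P.natDegree = n + 1 := by simp [hP, natDegree_prod_of_monic, monic_X_sub_C]
  -- Lagrange interpolation: the remainder modulo `P` is determined by its values at the `n + 1`
  -- simple roots.
  have h1 : ∑ k, C (q.eval (x k) / ∏ i, (x k - x (k.succAbove i))) *
      ∏ i, (X - C (x (k.succAbove i))) = q %ₘ P := by
    refine eq_of_natDegree_lt_card_of_eval_eq _ _ hx (fun k => ?_) (max_lt ?_ ?_)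
    · rw [eval_finsetSum, sum_eq_single k]
      · have h2 : ∏ i, (x k - x (k.succAbove i)) ≠ 0 :=
          prod_ne_zero_iff.2 fun i _ => sub_ne_zero.2 (hx.ne (Fin.succAbove_ne k i).symm)
        have h3 : P.eval (x k) = 0 := by
          rw [hP, eval_prod]
          exact prod_eq_zero (mem_univ k) (by simp)
        have h4 := congrArg (eval (x k)) (modByMonic_add_div q P)
        rw [eval_add, eval_mul, h3, zero_mul, add_zero] at h4
        rw [eval_mul, eval_prod, eval_C, h4]
        simp only [eval_sub, eval_X, eval_C]
        exact div_mul_cancel₀ _ h2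
      · intro j _ hj
        obtain ⟨i, hi⟩ := Fin.exists_succAbove_eq hj.symm
        rw [eval_mul, eval_prod, prod_eq_zero (f := fun i => eval (x k) (X - C (x (j.succAbove i))))
          (mem_univ i) (by simp [hi]), mul_zero]
      · simp
    · rw [Fintype.card_fin, Nat.lt_succ_iff]
      refine natDegree_sum_le_of_forall_le _ _ fun k _ => (natDegree_C_mul_le _ _).trans ?_
      simp [natDegree_prod_of_monic, monic_X_sub_C]
    · have := natDegree_modByMonic_lt q hPm (by rintro h; simp [h] at hPd)
      simpa [hPd] using this
  have hPe : toL P = ∏ i, lin (x i) := by simp [hP, map_prod, lin]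
  have hP0 : ∏ i, lin (x i) ≠ 0 := prod_ne_zero_iff.2 fun i _ => lin_ne_zero _
  conv_lhs => rw [← modByMonic_add_div q P, ← h1]
  rw [map_add, map_mul, hPe, prod_inv_distrib, add_mul, mul_right_comm, mul_inv_cancel₀ hP0,
    one_mul, add_comm, map_sum, sum_mul]
  congr 1
  refine sum_congr rfl fun k _ => ?_
  have h5 : ∏ i, lin (x (k.succAbove i)) ≠ 0 := prod_ne_zero_iff.2 fun i _ => lin_ne_zero _
  rw [map_mul, map_prod, mul_assoc, Fin.prod_univ_succAbove _ k]
  change _ * ((∏ i, lin (x (k.succAbove i))) * _) = _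
  rw [mul_inv, mul_left_comm (∏ i, lin (x (k.succAbove i))), mul_inv_cancel₀ h5, mul_one]

theorem res_partial_fractions {n : ℕ} (q : ℂ[X]) {x : Fin (n + 1) → ℂ}
    (hx : Function.Injective x) :
    res (toL q * ∏ i, (lin (x i))⁻¹) =
      ∑ k, q.eval (x k) / ∏ i, (x k - x (k.succAbove i)) := by
  rw [partial_fractions q hx, map_add, res_toL, zero_add, map_sum]
  refine sum_congr rfl fun k _ => ?_
  rw [res_C_mul, (MonicOrder.lin _).inv.res_eq_one, mul_one]

/-! ### Determinants of residues. -/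

/-- The change of basis from the powers of `X` to the `p j` is unitriangular. -/
theorem det_functional_monic {N : ℕ} (L : Fin N → ℂ[X] →ₗ[ℂ] ℂ) (p : Fin N → ℂ[X])
    (hd : ∀ j, (p j).natDegree = j) (hm : ∀ j, (p j).Monic) :
    (Matrix.of fun i j => L i (p j)).det = (Matrix.of fun i j : Fin N => L i (X ^ (j : ℕ))).det := by
  have h : (Matrix.of fun i j => L i (p j)) =
      (Matrix.of fun i j : Fin N => L i (X ^ (j : ℕ))) * Matrix.of fun i j : Fin N => (p j).coeff i := by
    ext i j
    rw [Matrix.mul_apply]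
    conv_lhs => rw [Matrix.of_apply, (p j).as_sum_range_C_mul_X_pow'
      (n := N) (by rw [hd]; exact j.2)]
    rw [map_sum, ← Fin.sum_univ_eq_sum_range (fun k => L i (C ((p j).coeff k) * X ^ k)) N]
    refine sum_congr rfl fun k _ => ?_
    rw [← smul_eq_C_mul, map_smul, smul_eq_mul, mul_comm]
    rfl
  rw [h, Matrix.det_mul]
  have := Matrix.det_matrixOfPolynomials p hd hm
  rw [this, mul_one]

/-- The functional `p ↦ res (φ p G)` on polynomials in `u`. -/
def resFun (φ G : LaurentSeries ℂ) : ℂ[X] →ₗ[ℂ] ℂ where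
  toFun p := res (φ * G * toL p)
  map_add' p q := by rw [map_add, mul_add, map_add]
  map_smul' c p := by
    rw [smul_eq_C_mul, map_mul toL, mul_left_comm, res_C_mul, RingHom.id_apply, smul_eq_mul]

theorem resFun_apply (φ G : LaurentSeries ℂ) (p : ℂ[X]) :
    resFun φ G p = res (φ * G * toL p) := rfl

/-- The determinant `det [res (φ_i u^j G)]`. -/
def resDet {N : ℕ} (φ : Fin N → LaurentSeries ℂ) (G : LaurentSeries ℂ) : ℂ :=
  (Matrix.of fun i j : Fin N => resFun (φ i) G (X ^ (j : ℕ))).det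

/-- A basis adapted to the point `x`: all its members but the first vanish at `x`, and their factor
`X - x` can be absorbed into `G`, where it removes a pole at `x` if there is one. -/
theorem det_cons_X_sub_C {M : ℕ} (L : Fin (M + 1) → ℂ[X] →ₗ[ℂ] ℂ) (x : ℂ) :
    (Matrix.of fun i j : Fin (M + 1) => L i (X ^ (j : ℕ))).det =
      (Matrix.of fun i => (Fin.cons (L i 1) fun j : Fin M => L i ((X - C x) * X ^ (j : ℕ)) :
        Fin (M + 1) → ℂ)).det := by
  rw [← det_functional_monic L (Fin.cons 1 fun j : Fin M => (X - C x) * X ^ (j : ℕ))]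
  · congr 1
    ext i j
    refine Fin.cases ?_ (fun j => ?_) j <;> simp
  · intro j
    refine Fin.cases ?_ (fun j => ?_) j
    · simp
    · rw [Fin.cons_succ, (monic_X_sub_C x).natDegree_mul (monic_X_pow _)]
      simp [add_comm]
  · intro j
    refine Fin.cases ?_ (fun j => ?_) j
    · simp
    · rw [Fin.cons_succ]
      exact (monic_X_sub_C x).mul (monic_X_pow _)

theorem resDet_cons {M : ℕ} (φ : Fin (M + 1) → LaurentSeries ℂ) (G : LaurentSeries ℂ) (x : ℂ) :
    resDet φ G = (Matrix.of fun i => (Fin.cons (res (φ i * G))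
      fun j : Fin M => resFun (φ i) (lin x * G) (X ^ (j : ℕ)) : Fin (M + 1) → ℂ)).det := by
  rw [resDet, det_cons_X_sub_C _ x]
  congr 1
  ext i j
  refine Fin.cases ?_ (fun j => ?_) j
  · simp [resFun_apply]
  · simp only [Matrix.of_apply, Fin.cons_succ, resFun_apply, map_mul, lin]
    congr 1
    ring

/-- By linearity the first row may be taken to be evaluation at a single point `z`. In the basis `1,
(X - z) X^j` that row is `(1, 0, …, 0)`, and the remaining minor is the determinant for `(u - z) G`.
-/
theorem resDet_expand_row {M m : ℕ} (φ : Fin (M + 1) → LaurentSeries ℂ) (G : LaurentSeries ℂ)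
    (x c : Fin m → ℂ) (h : ∀ p, resFun (φ 0) G p = ∑ k, c k * p.eval (x k)) :
    resDet φ G = ∑ k, c k * resDet (fun i => φ i.succ) (lin (x k) * G) := by
  have key : ∀ z : ℂ, ∑ j : Fin (M + 1), (-1) ^ (j : ℕ) * z ^ (j : ℕ) *
      ((Matrix.of fun i j : Fin (M + 1) => resFun (φ i) G (X ^ (j : ℕ))).submatrix Fin.succ
        j.succAbove).det = resDet (fun i => φ i.succ) (lin z * G) := by
    intro z
    have h1 := det_cons_X_sub_C (Fin.cons (leval z) fun i : Fin M => resFun (φ i.succ) G) z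
    rw [Matrix.det_succ_row_zero, Matrix.det_succ_row_zero] at h1
    refine Eq.trans ?_ (h1.trans ?_)
    · refine sum_congr rfl fun j _ => ?_
      congr 1
      simp [leval_apply]
    · rw [Fin.sum_univ_succ, sum_eq_zero, add_zero]
      · simp only [Fin.val_zero, pow_zero, Matrix.of_apply, Fin.cons_zero, one_mul, leval_apply,
          eval_one, resDet]
        congr 1
        ext i j
        simp only [Matrix.of_apply, Matrix.submatrix_apply, Fin.cons_succ, Fin.succAbove_zero,
          resFun_apply, map_mul, lin]
        congr 1
        ring
      · intro i _
        simp [leval_apply]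
  rw [resDet, Matrix.det_succ_row_zero]
  simp only [← key, Matrix.of_apply, h, mul_sum, sum_mul, eval_pow, eval_X]
  rw [sum_comm]
  refine sum_congr rfl fun k _ => sum_congr rfl fun j _ => ?_
  ring

theorem det_cons_column {M : ℕ} (v : Fin (M + 1) → ℂ) (B : Fin (M + 1) → Fin M → ℂ) :
    (Matrix.of fun i => (Fin.cons (v i) (B i) : Fin (M + 1) → ℂ)).det =
      ∑ i : Fin (M + 1), (-1) ^ (i : ℕ) * v i *
        (Matrix.of fun k => B (i.succAbove k)).det := by
  rw [Matrix.det_succ_column_zero]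
  refine sum_congr rfl fun i _ => ?_
  congr 2

theorem det_cons_eq_det_snoc {M : ℕ} (v : Fin (M + 1) → ℂ) (B : Fin (M + 1) → Fin M → ℂ) :
    (Matrix.of fun i => (Fin.snoc (B i) (v i) : Fin (M + 1) → ℂ)).det =
      (-1) ^ M * (Matrix.of fun i => (Fin.cons (v i) (B i) : Fin (M + 1) → ℂ)).det := by
  have h := Matrix.det_permute' (finRotate (M + 1))
    (Matrix.of fun i => (Fin.cons (v i) (B i) : Fin (M + 1) → ℂ))
  rw [sign_finRotate] at h
  simp only [Fin.snoc_eq_cons_rotate]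
  refine Eq.trans ?_ (h.trans ?_)
  · rfl
  · simp

/-- A monic `w` of degree `M` can replace `X^M`; the sign comes from moving its column from the last
place to the first. -/
theorem det_cons_monic {M : ℕ} (L : Fin (M + 1) → ℂ[X] →ₗ[ℂ] ℂ) (w : ℂ[X]) (hw : w.Monic)
    (hd : w.natDegree = M) :
    (Matrix.of fun i => (Fin.cons (L i w) fun j : Fin M => L i (X ^ (j : ℕ)) :
      Fin (M + 1) → ℂ)).det =
    (-1) ^ M * (Matrix.of fun i j : Fin (M + 1) => L i (X ^ (j : ℕ))).det := by
  rw [← det_functional_monic L (Fin.snoc (fun j : Fin M => X ^ (j : ℕ)) w)]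
  · have h := det_cons_eq_det_snoc (fun i => L i w) fun i (j : Fin M) => L i (X ^ (j : ℕ))
    have h1 : (Matrix.of fun i (j : Fin (M + 1)) =>
          L i ((Fin.snoc (fun j : Fin M => X ^ (j : ℕ)) w : Fin (M + 1) → ℂ[X]) j)) =
        Matrix.of fun i => (Fin.snoc (fun j : Fin M => L i (X ^ (j : ℕ))) (L i w) :
          Fin (M + 1) → ℂ) := by
      ext i j
      refine Fin.lastCases ?_ (fun j => ?_) j <;> simp
    rw [h1, h, ← mul_assoc, ← mul_pow]
    simp
  · intro j
    refine Fin.lastCases ?_ (fun j => ?_) j <;> simp [hd]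
  · intro j
    refine Fin.lastCases ?_ (fun j => ?_) j
    · simpa using hw
    · simp

/-- The sum is the residue of `q / ∏ (u - z_l)`, a series of the form `u⁻¹ (1 + O(u⁻¹))`. It settles
order zero in `resDet_expand_zeros`. -/
theorem sum_eval_div_of_monic {n : ℕ} (q : ℂ[X]) (hq : q.Monic) (hd : q.natDegree = n)
    {z : Fin (n + 1) → ℂ} (hz : Function.Injective z) :
    ∑ l, q.eval (z l) / ∏ i, (z l - z (l.succAbove i)) = 1 := by
  rw [← res_partial_fractions q hz]
  have h1 : ∀ m : ℕ, ∀ p : ℂ[X], p.Monic → p.natDegree = m → MonicOrder (-m) (toL p) := by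
    intro m
    induction m with
    | zero =>
      intro p hp hm
      rw [hp.natDegree_eq_zero.1 hm, map_one]
      simpa using MonicOrder.one
    | succ m ih =>
      intro p hp hm
      obtain ⟨x, hx⟩ := IsAlgClosed.exists_root p (by
        rw [degree_eq_natDegree hp.ne_zero, hm]; exact_mod_cast (Nat.succ_ne_zero m))
      obtain ⟨r, rfl⟩ := dvd_iff_isRoot.2 hx
      have hr : r.Monic := (monic_X_sub_C x).of_mul_monic_left hp
      have hrd : r.natDegree = m := by
        rw [(monic_X_sub_C x).natDegree_mul hr, natDegree_X_sub_C] at hm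
        omega
      rw [map_mul]
      convert (MonicOrder.lin x).mul (ih r hr hrd) using 1
      · push_cast; ring
      · rfl
  have h2 : ∀ m : ℕ, ∀ v : Fin m → ℂ, MonicOrder m (∏ i, (lin (v i))⁻¹) := by
    intro m
    induction m with
    | zero => intro v; simpa using MonicOrder.one
    | succ m ih =>
      intro v
      rw [Fin.prod_univ_succ]
      convert (MonicOrder.lin (v 0)).inv.mul (ih fun i => v i.succ) using 1
      push_cast; ring
  refine MonicOrder.res_eq_one ?_
  convert (h1 n q hq hd).mul (h2 (n + 1) z) using 1
  push_cast; ring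

/-- Expansion of `resDet` along the zeros of the numerator of `G`. -/
theorem resDet_expand_zeros {M n : ℕ} (φ : Fin M → LaurentSeries ℂ) (G : LaurentSeries ℂ)
    {A P : ℂ[X]} (hA : A.Monic) (hAd : A.natDegree = M) (hP : P.Monic) (hPd : P.natDegree = n)
    (hφ : ∀ i, ∃ f, φ i * toL A = toL f) {z : Fin (n + 1) → ℂ} (hz : Function.Injective z)
    (hG : G * toL P = ∏ i, lin (z i)) :
    resDet φ G = (-1) ^ M * ∑ l, (A * P).eval (z l) / (∏ i, (z l - z (l.succAbove i))) *
      resDet φ ((lin (z l))⁻¹ * G) := by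
  cases M with
  | zero =>
    have h1 : ∀ G, resDet φ G = 1 := fun G => Matrix.det_fin_zero
    simp only [h1, mul_one, pow_zero, one_mul]
    exact (sum_eval_div_of_monic _ (hA.mul hP) (by rw [hA.natDegree_mul hP]; omega) hz).symm
  | succ M =>
    set q : ℂ[X] := A * P with hq
    set Q : ℂ[X] := ∏ i, (X - C (z i)) with hQ
    have hQm : Q.Monic := monic_prod_of_monic _ _ fun i _ => monic_X_sub_C _
    have hQd : Q.natDegree = n + 1 := by simp [hQ, natDegree_prod_of_monic, monic_X_sub_C]
    have hqm : q.Monic := hA.mul hP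
    have hqd : q.natDegree = M + 1 + n := by rw [hq, hA.natDegree_mul hP]; omega
    have hwm : (q /ₘ Q).Monic := by
      rw [Monic, leadingCoeff_divByMonic_of_monic hQm, hqm]
      rw [degree_eq_natDegree hQm.ne_zero, degree_eq_natDegree hqm.ne_zero]
      exact_mod_cast (by omega)
    have hwd : (q /ₘ Q).natDegree = M := by
      rw [natDegree_divByMonic _ hQm]; omega
    -- In the basis adapted to `z l` the pole cancels in every column but the first, so only the
    -- first column depends on `l` and the sum over `l` can be taken there.
    have h1 : ∀ l, resDet φ ((lin (z l))⁻¹ * G) = ∑ i : Fin (M + 1), (-1) ^ (i : ℕ) *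
        res (φ i * ((lin (z l))⁻¹ * G)) *
        (Matrix.of fun k (j : Fin M) => resFun (φ (i.succAbove k)) G (X ^ (j : ℕ))).det := by
      intro l
      rw [resDet_cons _ _ (z l), mul_inv_cancel_left₀ (lin_ne_zero _), det_cons_column]
    -- Since `G = Q / P`, the product `φ_i G q / Q` equals `φ_i A`, a polynomial without residue.
    -- Hence the polar part of `q / Q` and its polynomial part contribute opposite residues.
    have h2 : ∀ i, ∑ l, q.eval (z l) / (∏ k, (z l - z (l.succAbove k))) *
        res (φ i * ((lin (z l))⁻¹ * G)) = - resFun (φ i) G (q /ₘ Q) := by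
      intro i
      obtain ⟨f, hf⟩ := hφ i
      have h3 := congrArg (fun r => res (φ i * G * r)) (partial_fractions q hz)
      simp only [mul_add, map_add, mul_sum, map_sum] at h3
      have h4 : φ i * G * (toL q * ∏ k, (lin (z k))⁻¹) = toL f := by
        rw [← hf, hq, map_mul, prod_inv_distrib, ← hG]
        have hG0 : G * toL P ≠ 0 := by
          rw [hG]; exact prod_ne_zero_iff.2 fun i _ => lin_ne_zero _
        rw [mul_inv]
        have := left_ne_zero_of_mul hG0
        have := right_ne_zero_of_mul hG0
        field_simp
      rw [h4, res_toL] at h3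
      rw [resFun_apply, eq_neg_iff_add_eq_zero, add_comm]
      refine Eq.trans ?_ h3.symm
      congr 1
      refine sum_congr rfl fun l _ => ?_
      rw [← res_C_mul]
      congr 1
      ring
    have h5 := det_cons_monic (fun i => resFun (φ i) G) (q /ₘ Q) hwm hwd
    rw [det_cons_column] at h5
    have h6 : ∑ l, q.eval (z l) / (∏ i, (z l - z (l.succAbove i))) *
        resDet φ ((lin (z l))⁻¹ * G) = ∑ i : Fin (M + 1), (-1) ^ (i : ℕ) *
        (-resFun (φ i) G (q /ₘ Q)) *
        (Matrix.of fun k (j : Fin M) => resFun (φ (i.succAbove k)) G (X ^ (j : ℕ))).det := by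
      simp only [h1, ← h2, mul_sum, sum_mul]
      rw [sum_comm]
      refine sum_congr rfl fun l _ => sum_congr rfl fun i _ => ?_
      ring
    rw [h6]
    simp only [mul_neg, neg_mul, sum_neg_distrib]
    rw [h5, resDet, pow_succ]
    have h7 : ((-1 : ℂ) ^ M) * (-1) ^ M = 1 := by rw [← mul_pow]; simp
    linear_combination (-(Matrix.of fun i j : Fin (M + 1) =>
      resFun (φ i) G (X ^ (j : ℕ))).det) * h7

theorem exists_polynomial_part (D : ℕ) (h : PowerSeries ℂ) :
    ∃ (p : ℂ[X]) (g : PowerSeries ℂ), p.natDegree ≤ D ∧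
      HahnSeries.single (-(D : ℤ)) (1 : ℂ) * (h : LaurentSeries ℂ) =
        toL p + HahnSeries.single (1 : ℤ) (1 : ℂ) * (g : LaurentSeries ℂ) := by
  induction D generalizing h with
  | zero =>
    obtain ⟨g, hg⟩ := PowerSeries.X_dvd_iff.2 (show PowerSeries.constantCoeff
      (h - PowerSeries.C (PowerSeries.constantCoeff h)) = 0 by simp)
    refine ⟨C (PowerSeries.constantCoeff h), g, by simp, ?_⟩
    have h1 : h = PowerSeries.C (PowerSeries.constantCoeff h) + PowerSeries.X * g := by
      rw [← hg]; ring
    conv_lhs => rw [h1]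
    rw [toL_C, ← PowerSeries.coe_X, ← PowerSeries.coe_mul,
      ← PowerSeries.coe_C, ← PowerSeries.coe_add]
    simp
  | succ D ih =>
    obtain ⟨k, hk⟩ := PowerSeries.X_dvd_iff.2 (show PowerSeries.constantCoeff
      (h - PowerSeries.C (PowerSeries.constantCoeff h)) = 0 by simp)
    obtain ⟨p, g, hp, hpg⟩ := ih k
    refine ⟨p + C (PowerSeries.constantCoeff h) * X ^ (D + 1), g,
      natDegree_add_le_of_degree_le (hp.trans D.le_succ) (natDegree_C_mul_X_pow_le _ _), ?_⟩
    have h1 : h = PowerSeries.C (PowerSeries.constantCoeff h) + PowerSeries.X * k := by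
      rw [← hk]; ring
    conv_lhs => rw [h1]
    rw [map_add toL, map_mul toL, map_pow toL, toL_C, toL_X, add_right_comm, ← hpg, uL, HahnSeries.single_pow,
      PowerSeries.coe_add, PowerSeries.coe_mul, PowerSeries.coe_X, PowerSeries.coe_C, mul_add,
      ← mul_assoc, HahnSeries.single_mul_single, add_comm, mul_comm (HahnSeries.C _),
      one_pow, mul_one, show -((D + 1 : ℕ) : ℤ) + 1 = -D by push_cast; ring,
      show (D + 1) • (-1 : ℤ) = -((D + 1 : ℕ) : ℤ) by simp]

/-- Only the first column depends on `t` in the basis adapted to `t`. Its entry, the residue of `φ_i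
G / (u - t)`, is the polynomial part of `φ_i G` evaluated at `t`. -/
theorem polyLE_resDet_pole {N D : ℕ} (φ : Fin N → LaurentSeries ℂ) (G : LaurentSeries ℂ)
    (h : ∀ i, ∃ z : ℤ, -(D : ℤ) ≤ z ∧ MonicOrder z (φ i * G)) :
    PolyLE D fun t => resDet φ ((lin t)⁻¹ * G) := by
  cases N with
  | zero =>
    have : (fun t => resDet φ ((lin t)⁻¹ * G)) = fun _ => 1 := by
      funext t
      exact Matrix.det_fin_zero
    rw [this]
    exact PolyLE.const _ _
  | succ N =>
    have h1 : ∀ t, resDet φ ((lin t)⁻¹ * G) = ∑ i : Fin (N + 1), (-1) ^ (i : ℕ) *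
        res (φ i * ((lin t)⁻¹ * G)) *
        (Matrix.of fun k (j : Fin N) => resFun (φ (i.succAbove k)) G (X ^ (j : ℕ))).det := by
      intro t
      rw [resDet_cons _ _ t, mul_inv_cancel_left₀ (lin_ne_zero _), det_cons_column]
    simp only [h1]
    refine PolyLE.sum _ fun i _ => ?_
    have h2 : PolyLE D fun t => res (φ i * ((lin t)⁻¹ * G)) := by
      obtain ⟨z, hz, f, _, hf⟩ := h i
      obtain ⟨k, hk⟩ := Int.le.dest hz
      obtain ⟨p, g, hp, hpg⟩ := exists_polynomial_part D (PowerSeries.X ^ k * f)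
      have h4 : HahnSeries.single z (1 : ℂ) =
          HahnSeries.single (-(D : ℤ)) (1 : ℂ) * HahnSeries.single (k : ℤ) (1 : ℂ) := by
        rw [HahnSeries.single_mul_single, hk, one_mul]
      have h5 : φ i * G = toL p + HahnSeries.single (1 : ℤ) (1 : ℂ) * (g : LaurentSeries ℂ) := by
        rw [hf, h4, mul_assoc, ← hpg, PowerSeries.coe_mul, PowerSeries.coe_pow,
          PowerSeries.coe_X, RatFunc.single_one_eq_pow]
      refine ⟨p, hp, fun t => ?_⟩
      have h6 : MonicOrder 2 ((lin t)⁻¹ * HahnSeries.single (1 : ℤ) (1 : ℂ)) := by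
        have := (MonicOrder.lin t).inv.mul (w := 1) (g := HahnSeries.single (1 : ℤ) (1 : ℂ))
          ⟨1, by simp, by simp⟩
        simpa using this
      change _ = res (φ i * ((lin t)⁻¹ * G))
      rw [mul_left_comm, h5, mul_add, map_add, mul_comm, res_toL_mul_inv, ← mul_assoc,
        h6.res_mul one_lt_two, add_zero]
    have h3 := (h2.const_mul ((-1) ^ (i : ℕ))).mul (PolyLE.const 0
      (Matrix.of fun k (j : Fin N) => resFun (φ (i.succAbove k)) G (X ^ (j : ℕ))).det)
    exact h3

/-- Every entry is affine in `t`, because the extra factor is `u + t`. -/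
theorem polyLE_resDet_zero {N : ℕ} (φ : Fin N → LaurentSeries ℂ) (G : LaurentSeries ℂ) :
    PolyLE N fun t => resDet φ (lin (-t) * G) := by
  simp only [resDet, Matrix.det_apply, Units.smul_def, zsmul_eq_mul]
  refine PolyLE.sum _ fun w _ => PolyLE.const_mul _ ?_
  have h := PolyLE.prod univ (D := fun _ => 1) (g := fun i t =>
    (Matrix.of fun i j : Fin N => resFun (φ i) (lin (-t) * G) (X ^ (j : ℕ))) (w i) i) fun i _ => ?_
  · simpa using h
  · refine ⟨C (res (φ (w i) * (uL * G) * toL (X ^ (i : ℕ)))) +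
      C (res (φ (w i) * G * toL (X ^ (i : ℕ)))) * X, ?_, fun t => ?_⟩
    · exact natDegree_add_le_of_degree_le (by simp) ((natDegree_C_mul_le _ _).trans natDegree_X_le)
    · change _ = resFun (φ (w i)) (lin (-t) * G) (X ^ (i : ℕ))
      rw [resFun_apply, lin, C_neg, sub_neg_eq_add, map_add, toL_X, eval_add,
        eval_mul, eval_C, eval_C, eval_X, mul_comm _ t, ← res_C_mul, ← map_add]
      congr 1
      ring

/-! ### Factorial powers of integral exponent and the determinant for `G`. -/

/-- The polynomial `(X | a)^m`. -/
def facPoly (a : ℤ → ℂ) (m : ℕ) : ℂ[X] := ∏ k ∈ range m, (X - C (a ((k : ℤ) + 1)))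

theorem facPoly_monic (a : ℤ → ℂ) (m : ℕ) : (facPoly a m).Monic :=
  monic_prod_of_monic _ _ fun _ _ => monic_X_sub_C _

theorem natDegree_facPoly (a : ℤ → ℂ) (m : ℕ) : (facPoly a m).natDegree = m := by
  simp [facPoly, natDegree_prod_of_monic, monic_X_sub_C]

/-- The polynomial `(X - a_0) (X - a_{-1}) ⋯ (X - a_{1-m})`. -/
def lowerPoly (a : ℤ → ℂ) (m : ℕ) : ℂ[X] := ∏ k ∈ range m, (X - C (a (-(k : ℤ))))

theorem lowerPoly_monic (a : ℤ → ℂ) (m : ℕ) : (lowerPoly a m).Monic :=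
  monic_prod_of_monic _ _ fun _ _ => monic_X_sub_C _

theorem natDegree_lowerPoly (a : ℤ → ℂ) (m : ℕ) : (lowerPoly a m).natDegree = m := by
  simp [lowerPoly, natDegree_prod_of_monic, monic_X_sub_C]

theorem eval_lowerPoly_neg (a : ℤ → ℂ) (m : ℕ) (t : ℂ) :
    (lowerPoly a m).eval (-t) = (-1) ^ m * (facPoly (dualSeq a) m).eval t := by
  rw [lowerPoly, facPoly, eval_prod, eval_prod]
  rw [← card_range m, ← prod_const, card_range, ← prod_mul_distrib]
  refine prod_congr rfl fun k _ => ?_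
  simp [dualSeq]
  ring

/-- The factorial power `(u | a)^z` with an arbitrary integral exponent. -/
def facZ (a : ℤ → ℂ) : ℤ → LaurentSeries ℂ
  | Int.ofNat m => toL (facPoly a m)
  | Int.negSucc m => (toL (lowerPoly a (m + 1)))⁻¹

theorem facZ_natCast (a : ℤ → ℂ) (m : ℕ) : facZ a m = toL (facPoly a m) := rfl

theorem facZ_neg_natCast (a : ℤ → ℂ) (m : ℕ) : facZ a (-m) = (toL (lowerPoly a m))⁻¹ := by
  cases m with
  | zero => simp [facPoly, lowerPoly, show facZ a 0 = _ from facZ_natCast a 0]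
  | succ m => rfl

theorem facZ_add_one (a : ℤ → ℂ) (z : ℤ) : facZ a (z + 1) = facZ a z * lin (a (z + 1)) := by
  obtain ⟨m, rfl | rfl⟩ := z.eq_nat_or_neg
  · rw [← Nat.cast_succ, facZ_natCast, facZ_natCast, facPoly, prod_range_succ, map_mul]
    simp [lin, facPoly]
  · cases m with
    | zero =>
      have h1 := facZ_natCast a 1
      have h0 := facZ_natCast a 0
      simp only [Nat.cast_one, Nat.cast_zero] at h0 h1
      simp [h0, h1, lin, facPoly]
    | succ m =>
      rw [show -((m + 1 : ℕ) : ℤ) + 1 = -(m : ℤ) by push_cast; ring, facZ_neg_natCast,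
        facZ_neg_natCast, lowerPoly, lowerPoly, prod_range_succ, map_mul, mul_inv]
      change _ = _ * (lin (a (-m)))⁻¹ * _
      rw [inv_mul_cancel_right₀ (lin_ne_zero _)]

theorem facZ_add (a : ℤ → ℂ) (k z : ℤ) : facZ a (z + k) = facZ a k * facZ (shift k a) z := by
  have h0 : facZ (shift k a) 0 = 1 := by
    have := facZ_natCast (shift k a) 0
    simpa [facPoly] using this
  have hs : ∀ z, facZ a (z + 1 + k) = facZ a (z + k) * lin (shift k a (z + 1)) := fun z => by
    rw [show z + 1 + k = z + k + 1 by ring, facZ_add_one, shift,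
      show z + k + 1 = z + 1 + k by ring]
  induction z using Int.induction_on with
  | zero => rw [zero_add, h0, mul_one]
  | succ i ih => rw [hs, ih, facZ_add_one, mul_assoc]
  | pred i ih =>
    have h1 := hs (-(i : ℤ) - 1)
    have h2 := facZ_add_one (shift k a) (-(i : ℤ) - 1)
    rw [sub_add_cancel] at h1 h2
    rw [h1, h2, ← mul_assoc] at ih
    exact mul_right_cancel₀ (lin_ne_zero _) ih

theorem monicOrder_facZ (a : ℤ → ℂ) (z : ℤ) : MonicOrder (-z) (facZ a z) := by
  induction z using Int.induction_on with
  | zero =>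
    have := facZ_natCast a 0
    have h0 : facZ a 0 = 1 := by simpa [facPoly] using this
    simpa [h0] using MonicOrder.one
  | succ i ih =>
    rw [facZ_add_one]
    convert ih.mul (MonicOrder.lin _) using 1
    ring
  | pred i ih =>
    have h2 := facZ_add_one a (-(i : ℤ) - 1)
    rw [sub_add_cancel] at h2
    rw [← mul_inv_cancel_right₀ (lin_ne_zero (a (-(i : ℤ)))) (facZ a (-(i : ℤ) - 1)), ← h2]
    convert ih.mul (MonicOrder.lin _).inv using 1
    ring

theorem res_facZ (a : ℤ → ℂ) (z : ℤ) : res (facZ a z) = if z = -1 then 1 else 0 := by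
  split_ifs with h
  · subst h
    exact MonicOrder.res_eq_one (by simpa using monicOrder_facZ a (-1))
  · rcases le_or_gt 0 z with hz | hz
    · lift z to ℕ using hz
      rw [facZ_natCast, res_toL]
    · have := (monicOrder_facZ a z).res_mul (by omega) 1
      simpa using this

/-- The super generating function `∏ (u + y_j) / ∏ (u - x_i)`. -/
def genFun {m n : ℕ} (x : Fin m → ℂ) (y : Fin n → ℂ) : LaurentSeries ℂ :=
  (∏ j, lin (-y j)) * ∏ i, (lin (x i))⁻¹

theorem monicOrder_prod {n : ℕ} {e : ℤ} {f : Fin n → LaurentSeries ℂ}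
    (h : ∀ i, MonicOrder e (f i)) : MonicOrder (n * e) (∏ i, f i) := by
  induction n with
  | zero => simpa using MonicOrder.one
  | succ n ih =>
    rw [Fin.prod_univ_succ]
    convert (h 0).mul (ih fun i => h i.succ) using 1
    push_cast; ring

theorem monicOrder_genFun {m n : ℕ} (x : Fin m → ℂ) (y : Fin n → ℂ) :
    MonicOrder (m - n) (genFun x y) := by
  have h1 := monicOrder_prod fun j => MonicOrder.lin (-y j)
  have h2 := monicOrder_prod fun i => (MonicOrder.lin (x i)).inv
  convert h1.mul h2 using 1
  · ring
  · rfl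

theorem genFun_succAbove_left {m n : ℕ} (x : Fin (m + 1) → ℂ) (y : Fin n → ℂ) (k : Fin (m + 1)) :
    lin (x k) * genFun x y = genFun (x ∘ k.succAbove) y := by
  rw [genFun, genFun, Fin.prod_univ_succAbove _ k, mul_left_comm,
    mul_inv_cancel_left₀ (lin_ne_zero _)]
  rfl

theorem genFun_succAbove_right {m n : ℕ} (x : Fin m → ℂ) (y : Fin (n + 1) → ℂ) (l : Fin (n + 1)) :
    (lin (-y l))⁻¹ * genFun x y = genFun x (y ∘ l.succAbove) := by
  rw [genFun, genFun, Fin.prod_univ_succAbove _ l, mul_assoc,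
    inv_mul_cancel_left₀ (lin_ne_zero _)]
  rfl

theorem genFun_cancel {n : ℕ} (x : Fin n → ℂ) (y : Fin (n + 1) → ℂ) (l : Fin (n + 1)) :
    genFun (Fin.cons (-y l) x : Fin (n + 1) → ℂ) y = genFun x (y ∘ l.succAbove) := by
  rw [← genFun_succAbove_right, genFun, genFun, Fin.prod_univ_succ (n := n) (f := fun i => (lin _)⁻¹)]
  simp only [Fin.cons_zero, Fin.cons_succ]
  ring

/-- The determinant `s_{μ;a}` of order `N` for the generating function `G`. -/
def schurDet (N : ℕ) (μ : YoungDiagram) (a : ℤ → ℂ) (G : LaurentSeries ℂ) : ℂ :=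
  resDet (fun i : Fin N => facZ a ((μ.rowLen i : ℤ) - i - 1)) G

/-- Without the pole at `t`, `G` has `n` poles and `n + 1` zeros and grows like `u`. This offsets
the `-1` in the exponents, so row `i` has degree `μ_i - i ≤ μ_1` at infinity (`i` from zero). -/
theorem polyLE_schurDet_left {n : ℕ} (N : ℕ) (μ : YoungDiagram) (a : ℤ → ℂ) (x : Fin n → ℂ)
    (y : Fin (n + 1) → ℂ) :
    PolyLE (μ.rowLen 0) fun t => schurDet N μ a (genFun (Fin.cons t x : Fin (n + 1) → ℂ) y) := by
  have h1 : ∀ t, genFun (Fin.cons t x : Fin (n + 1) → ℂ) y = (lin t)⁻¹ * genFun x y := by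
    intro t
    rw [genFun, genFun, Fin.prod_univ_succ (n := n) (f := fun i => (lin _)⁻¹)]
    simp only [Fin.cons_zero, Fin.cons_succ]
    ring
  simp only [h1, schurDet]
  refine polyLE_resDet_pole _ _ fun i => ⟨_, ?_, (monicOrder_facZ a _).mul (monicOrder_genFun x y)⟩
  have := μ.rowLen_anti _ _ (Nat.zero_le i)
  push_cast
  omega

theorem polyLE_schurDet_right {m n : ℕ} (N : ℕ) (μ : YoungDiagram) (a : ℤ → ℂ) (x : Fin m → ℂ)
    (y : Fin n → ℂ) :
    PolyLE N fun t => schurDet N μ a (genFun x (Fin.cons t y : Fin (n + 1) → ℂ)) := by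
  have h1 : ∀ t, genFun x (Fin.cons t y : Fin (n + 1) → ℂ) = lin (-t) * genFun x y := by
    intro t
    rw [genFun, genFun, Fin.prod_univ_succ]
    simp only [Fin.cons_zero, Fin.cons_succ]
    ring
  simp only [h1, schurDet]
  exact polyLE_resDet_zero _ _

/-- The first exponent `μ_1 - 1` is nonnegative, so the first row has finite poles only at the
`x_k`. All rows counted by the order are nonempty, so each later exponent is the one belonging to
the diagram without its first hook. -/
theorem schurDet_expand_row {n M : ℕ} (μ : YoungDiagram) (a : ℤ → ℂ) (hM : μ.colLen 0 = M + 1)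
    {x y : Fin (n + 1) → ℂ} (h : Generic x y) :
    schurDet (M + 1) μ a (genFun x y) = ∑ k : Fin (n + 1),
      (facPoly a (μ.rowLen 0 - 1)).eval (x k) * (∏ j, (x k + y j)) /
          (∏ i, (x k - x (k.succAbove i))) *
        schurDet M (removeHook μ) a (genFun (x ∘ k.succAbove) y) := by
  have hpos : ∀ i : ℕ, i ≤ M → 0 < μ.rowLen i := fun i hi =>
    YoungDiagram.mem_iff_lt_rowLen.1 (YoungDiagram.mem_iff_lt_colLen.2 (by omega))
  have h0 := hpos 0 (Nat.zero_le _)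
  have hrow : ∀ p, resFun (facZ a ((μ.rowLen (0 : Fin (M + 1)) : ℤ) - (0 : Fin (M + 1)) - 1))
      (genFun x y) p = ∑ k, (facPoly a (μ.rowLen 0 - 1)).eval (x k) * (∏ j, (x k + y j)) /
          (∏ i, (x k - x (k.succAbove i))) * p.eval (x k) := by
    intro p
    have h1 := res_partial_fractions (facPoly a (μ.rowLen 0 - 1) * (∏ j, (X - C (-y j))) * p) h.1
    have h2 : (μ.rowLen ((0 : Fin (M + 1)) : ℕ) : ℤ) - ((0 : Fin (M + 1)) : ℕ) - 1 =
        ((μ.rowLen 0 - 1 : ℕ) : ℤ) := by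
      rw [Fin.val_zero]; omega
    rw [h2, facZ_natCast, resFun_apply, genFun]
    refine Eq.trans ?_ (h1.trans ?_)
    · congr 1
      rw [map_mul, map_mul, map_prod]
      simp only [lin]
      ring
    · refine sum_congr rfl fun k _ => ?_
      rw [eval_mul, eval_mul, eval_prod]
      simp only [eval_sub, eval_X, eval_C, sub_neg_eq_add]
      ring
  have hφ : (fun i : Fin M => facZ a ((μ.rowLen (i.succ : Fin (M + 1)) : ℤ) -
      (i.succ : Fin (M + 1)) - 1)) =
      fun i : Fin M => facZ a (((removeHook μ).rowLen i : ℤ) - i - 1) := by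
    funext i
    have hi := hpos (i + 1) i.2
    rw [rowLen_removeHook, Fin.val_succ]
    exact congrArg (facZ a) (by omega)
  have key := resDet_expand_row
    (fun i : Fin (M + 1) => facZ a ((μ.rowLen i : ℤ) - i - 1)) (genFun x y) x _ hrow
  simp only [hφ, genFun_succAbove_left] at key
  exact key

/-- The exponents are at least `-M`, so `lowerPoly a M` is a common denominator of the rows. Its
value at `-y_l` is, up to sign, the dual factorial power of `y_l`; this is how the sequence `â`
arises. -/
theorem schurDet_expand_zeros {n M : ℕ} (μ : YoungDiagram) (a : ℤ → ℂ)
    {x : Fin n → ℂ} {y : Fin (n + 1) → ℂ} (h : Generic x y) :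
    schurDet M μ a (genFun x y) = ∑ l : Fin (n + 1),
        (facPoly (dualSeq a) M).eval (y l) * (∏ i, (x i + y l)) /
          (∏ j, (y l - y (l.succAbove j))) *
        schurDet M μ a (genFun x (y ∘ l.succAbove)) := by
  have hφ : ∀ i : Fin M, ∃ f, facZ a ((μ.rowLen i : ℤ) - i - 1) * toL (lowerPoly a M) =
      toL f := by
    intro i
    have hi2 := i.2
    obtain ⟨e, he⟩ := Int.le.dest (show -(M : ℤ) ≤ (μ.rowLen i : ℤ) - (i : ℕ) - 1 by omega)
    refine ⟨facPoly (shift (-M) a) e, ?_⟩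
    rw [← he, add_comm, facZ_add, facZ_neg_natCast, facZ_natCast, mul_right_comm,
      inv_mul_cancel₀, one_mul]
    have h3 := (monicOrder_facZ a (-M)).ne_zero
    rw [facZ_neg_natCast] at h3
    exact fun h4 => h3 (by rw [h4, inv_zero])
  have hG : genFun x y * toL (∏ i, (X - C (x i))) = ∏ i, lin (-y i) := by
    have h4 : ∏ i, lin (x i) ≠ 0 := prod_ne_zero_iff.2 fun i _ => lin_ne_zero _
    rw [genFun, prod_inv_distrib, map_prod, mul_assoc]
    change _ * ((∏ i, lin (x i))⁻¹ * ∏ i, lin (x i)) = _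
    rw [inv_mul_cancel₀ h4, mul_one]
  have h8 : ((-1 : ℂ) ^ M) * (-1) ^ M = 1 := by rw [← mul_pow]; simp
  have h9 : ((-1 : ℂ) ^ n) ≠ 0 := pow_ne_zero _ (by norm_num)
  rw [schurDet, resDet_expand_zeros _ _ (lowerPoly_monic a M) (natDegree_lowerPoly a M)
    (monic_prod_of_monic _ _ fun i _ => monic_X_sub_C _)
    (by simp [natDegree_prod_of_monic, monic_X_sub_C]) hφ
    (show Function.Injective (fun l => -y l) from neg_injective.comp h.2) hG, mul_sum]
  refine sum_congr rfl fun l _ => ?_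
  have h6 : ∏ j, eval (-y l) (X - C (x j)) = (-1) ^ n * ∏ i, (x i + y l) := by
    rw [← Fin.prod_const, ← prod_mul_distrib]
    exact prod_congr rfl fun i _ => by simp; ring
  have h7 : ∏ i, (-y l - -y (l.succAbove i)) = (-1) ^ n * ∏ j, (y l - y (l.succAbove j)) := by
    rw [← Fin.prod_const, ← prod_mul_distrib]
    exact prod_congr rfl fun i _ => by ring
  rw [genFun_succAbove_right, eval_mul, eval_lowerPoly_neg, eval_prod, h6, h7, schurDet,
    mul_left_comm ((-1 : ℂ) ^ M * _), mul_div_mul_left _ _ h9]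
  linear_combination ((facPoly (dualSeq a) M).eval (y l) * (∏ i, (x i + y l)) /
    (∏ j, (y l - y (l.succAbove j))) * resDet (fun i : Fin M => facZ a ((μ.rowLen i : ℤ) - i - 1))
      (genFun x (y ∘ l.succAbove))) * h8

end

section

open Finset Equiv

/-! ### Symmetric functions at a point as residues. -/

/-- The value of a symmetric function at the point `(x; y)`. -/
def evalAt {n : ℕ} (x y : Fin n → ℂ) : SymFun →+* ℂ :=
  (MvPolynomial.eval (Sum.elim x y)).comp (superEval n : SymFun →+* Poly n)

theorem evalAt_C {n : ℕ} (x y : Fin n → ℂ) (c : ℂ) : evalAt x y (MvPolynomial.C c) = c := by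
  simp [evalAt]

theorem evalAt_X {n : ℕ} (x y : Fin n → ℂ) (k : ℕ) :
    evalAt x y (MvPolynomial.X k) = ∑ i, x i ^ (k + 1) + (-1) ^ k * ∑ i, y i ^ (k + 1) := by
  simp [evalAt, superEval, xv, yv]

theorem evalAt_smul {n : ℕ} (x y : Fin n → ℂ) (c : ℂ) (f : SymFun) :
    evalAt x y (c • f) = c * evalAt x y f := by
  rw [MvPolynomial.smul_eq_C_mul, map_mul, evalAt_C]

theorem derivative_hSeries :
    PowerSeries.derivative SymFun hSeries =
      PowerSeries.mk (fun k => (MvPolynomial.X k : SymFun)) * hSeries := by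
  rw [hSeries, PowerSeries.derivative_subst hasSubst_powerSumSeries, PowerSeries.derivative_exp,
    mul_comm]
  congr 1
  ext k : 1
  rw [PowerSeries.coeff_derivative, powerSumSeries, PowerSeries.coeff_mk, PowerSeries.coeff_mk,
    show ((k : SymFun) + 1) = MvPolynomial.C ((k : ℂ) + 1) by simp, mul_right_comm,
    ← map_mul, inv_mul_cancel₀ (Nat.cast_add_one_ne_zero k), map_one, one_mul]

theorem constantCoeff_hSeries : PowerSeries.constantCoeff hSeries = 1 := by
  have h := coeff_hSeries 0 0
  rw [zero_add, sum_range_one, coeff_recipSeries_self, one_smul, hNat_zero,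
    PowerSeries.coeff_zero_eq_constantCoeff_apply] at h
  exact h

/-- A power series is determined by its logarithmic derivative and its constant term. -/
theorem eq_of_derivative_eq_mul {f g p : PowerSeries ℂ}
    (hf : PowerSeries.derivative ℂ f = p * f) (hg : PowerSeries.derivative ℂ g = p * g)
    (hf1 : PowerSeries.constantCoeff f = 1) (hg1 : PowerSeries.constantCoeff g = 1) : f = g := by
  have hgi : g * g⁻¹ = 1 := PowerSeries.mul_inv_cancel _ (by simp [hg1])
  have hi : PowerSeries.derivative ℂ g⁻¹ = - (p * g⁻¹) := by
    have h := congrArg (PowerSeries.derivative ℂ) hgi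
    simp only [Derivation.leibniz, Derivation.map_one_eq_zero, smul_eq_mul, hg] at h
    linear_combination g⁻¹ * h - (p * g⁻¹ + PowerSeries.derivative ℂ g⁻¹) * hgi
  have h1 : f * g⁻¹ = 1 := by
    refine PowerSeries.derivative.ext ?_ ?_
    · simp only [Derivation.leibniz, Derivation.map_one_eq_zero, smul_eq_mul, hf, hi]
      ring
    · simp [hf1, hg1]
  linear_combination g * h1 - f * hgi

theorem derivative_prod_eq_mul {n : ℕ} {f p : Fin n → PowerSeries ℂ}
    (h : ∀ i, PowerSeries.derivative ℂ (f i) = p i * f i) :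
    PowerSeries.derivative ℂ (∏ i, f i) = (∑ i, p i) * ∏ i, f i := by
  induction n with
  | zero => simp
  | succ n ih =>
    rw [Fin.prod_univ_succ, Fin.sum_univ_succ, Derivation.leibniz, h, ih fun i => h i.succ,
      smul_eq_mul, smul_eq_mul]
    ring

/-- The geometric series `1 / (1 - x t)`. -/
def geom (x : ℂ) : PowerSeries ℂ := PowerSeries.mk fun k => x ^ k

theorem constantCoeff_geom (x : ℂ) : PowerSeries.constantCoeff (geom x) = 1 := by
  rw [← PowerSeries.coeff_zero_eq_constantCoeff_apply, geom, PowerSeries.coeff_mk, pow_zero]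

theorem geom_mul (x : ℂ) : geom x * (1 - PowerSeries.C x * PowerSeries.X) = 1 := by
  ext k
  rw [mul_sub, mul_one, mul_left_comm, map_sub, PowerSeries.coeff_C_mul, geom]
  cases k with
  | zero => simp
  | succ k => rw [PowerSeries.coeff_succ_mul_X]; simp [PowerSeries.coeff_one, pow_succ']

theorem derivative_linear (c : ℂ) :
    PowerSeries.derivative ℂ (1 - PowerSeries.C c * PowerSeries.X) = - PowerSeries.C c := by
  simp [Derivation.leibniz]

theorem derivative_geom (x : ℂ) :
    PowerSeries.derivative ℂ (geom x) = (PowerSeries.C x * geom x) * geom x := by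
  have h := congrArg (PowerSeries.derivative ℂ) (geom_mul x)
  rw [Derivation.leibniz, derivative_linear, Derivation.map_one_eq_zero, smul_eq_mul,
    smul_eq_mul] at h
  linear_combination geom x * h - PowerSeries.derivative ℂ (geom x) * geom_mul x

theorem derivative_linear_eq_mul (y : ℂ) :
    PowerSeries.derivative ℂ (1 - PowerSeries.C (-y) * PowerSeries.X) =
      (PowerSeries.C y * geom (-y)) * (1 - PowerSeries.C (-y) * PowerSeries.X) := by
  rw [derivative_linear, mul_assoc, geom_mul, map_neg, neg_neg, mul_one]

/-- Both sides have constant term `1` and the same logarithmic derivative, the generating series of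
the evaluated power sums. -/
theorem map_hSeries {n : ℕ} (x y : Fin n → ℂ) :
    PowerSeries.map (evalAt x y) hSeries =
      (∏ j, (1 - PowerSeries.C (-y j) * PowerSeries.X)) * ∏ i, geom (x i) := by
  have h1 : PowerSeries.map (evalAt x y) (PowerSeries.mk fun k => (MvPolynomial.X k : SymFun)) =
      (∑ j, PowerSeries.C (y j) * geom (-y j)) + ∑ i, PowerSeries.C (x i) * geom (x i) := by
    ext k
    simp only [PowerSeries.coeff_map, PowerSeries.coeff_mk, evalAt_X, map_add, map_sum,
      PowerSeries.coeff_C_mul, geom, mul_sum]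
    rw [add_comm]
    congr 1
    · refine sum_congr rfl fun j _ => ?_
      rw [neg_pow]; ring
    · exact sum_congr rfl fun i _ => by ring
  refine eq_of_derivative_eq_mul (p := PowerSeries.map (evalAt x y)
    (PowerSeries.mk fun k => (MvPolynomial.X k : SymFun))) ?_ ?_ ?_ ?_
  · rw [← map_mul, ← derivative_hSeries]
    ext k
    simp [PowerSeries.coeff_derivative]
  · rw [Derivation.leibniz, derivative_prod_eq_mul fun j => derivative_linear_eq_mul (y j),
      derivative_prod_eq_mul fun i => derivative_geom (x i), h1, smul_eq_mul, smul_eq_mul]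
    ring
  · rw [← PowerSeries.coeff_zero_eq_constantCoeff_apply, PowerSeries.coeff_map,
      PowerSeries.coeff_zero_eq_constantCoeff_apply, constantCoeff_hSeries, map_one]
  · simp [map_prod, constantCoeff_geom]

theorem coe_linear (x : ℂ) :
    ((1 - PowerSeries.C x * PowerSeries.X : PowerSeries ℂ) : LaurentSeries ℂ) =
      HahnSeries.single (1 : ℤ) (1 : ℂ) * lin x := by
  rw [lin, map_sub toL, toL_X, toL_C, uL, mul_sub, HahnSeries.single_mul_single,
    PowerSeries.coe_sub, PowerSeries.coe_mul, PowerSeries.coe_X, PowerSeries.coe_C,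
    PowerSeries.coe_one, mul_comm (HahnSeries.C x)]
  simp

theorem coe_geom (x : ℂ) :
    (geom x : LaurentSeries ℂ) = HahnSeries.single (-1 : ℤ) (1 : ℂ) * (lin x)⁻¹ := by
  have h := congrArg (HahnSeries.ofPowerSeries ℤ ℂ) (geom_mul x)
  rw [map_mul, coe_linear, PowerSeries.coe_one] at h
  have h1 : HahnSeries.single (-1 : ℤ) (1 : ℂ) * HahnSeries.single (1 : ℤ) (1 : ℂ) = 1 := by
    rw [HahnSeries.single_mul_single]; simp
  have h2 := mul_inv_cancel₀ (lin_ne_zero x)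
  linear_combination (HahnSeries.single (-1 : ℤ) (1 : ℂ) * (lin x)⁻¹) * h -
    (geom x : LaurentSeries ℂ) * lin x * (lin x)⁻¹ * h1 - (geom x : LaurentSeries ℂ) * h2

/-- The powers of `t` from the linear factors cancel because the two groups have equally many
variables. -/
theorem coe_map_hSeries {n : ℕ} (x y : Fin n → ℂ) :
    (PowerSeries.map (evalAt x y) hSeries : LaurentSeries ℂ) = genFun x y := by
  rw [map_hSeries, map_mul, map_prod, map_prod, genFun]
  simp only [coe_linear, coe_geom, prod_mul_distrib, prod_const, card_univ, Fintype.card_fin]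
  rw [mul_mul_mul_comm, ← mul_pow, HahnSeries.single_mul_single]
  simp

theorem coe_recipSeries (b : ℤ → ℂ) (k : ℕ) :
    (recipSeries b k : LaurentSeries ℂ) = (facZ b k)⁻¹ := by
  refine eq_inv_of_mul_eq_one_left ?_
  set p : PowerSeries ℂ := ∏ i ∈ range k, (1 - PowerSeries.C (b ((i : ℤ) + 1)) * PowerSeries.X)
    with hp
  have h1 : (p : LaurentSeries ℂ) = HahnSeries.single (1 : ℤ) (1 : ℂ) ^ k * facZ b k := by
    rw [hp, map_prod, facZ_natCast, facPoly, map_prod]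
    simp only [coe_linear, prod_mul_distrib, prod_const, card_range]
    rfl
  have h2 : p⁻¹ * p = 1 := PowerSeries.inv_mul_cancel _ (by simp [hp, map_prod])
  have h3 := congrArg (HahnSeries.ofPowerSeries ℤ ℂ) h2
  rw [map_mul, h1, PowerSeries.coe_one] at h3
  rw [recipSeries, ← hp, map_mul, map_pow, PowerSeries.coe_X]
  linear_combination h3

/-- Multiplying the defining expansion of `H` by `(u|b)^{m-1}` turns its `k`-th term into a multiple
of `(u|τ^k b)^{m-1-k}`, whose residue is `1` for `k = m` and `0` otherwise. -/
theorem evalAt_hInt {n : ℕ} (x y : Fin n → ℂ) (b : ℤ → ℂ) (m : ℤ) :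
    evalAt x y (hInt b m) = res (facZ b (m - 1) * genFun x y) := by
  set N := m.toNat with hN
  obtain ⟨g, hg⟩ : (PowerSeries.X : PowerSeries ℂ) ^ (N + 1) ∣
      PowerSeries.map (evalAt x y) hSeries - ∑ k ∈ range (N + 1),
        PowerSeries.C (evalAt x y (hNat b k)) * recipSeries b k := by
    rw [PowerSeries.X_pow_dvd_iff]
    intro d hd
    rw [map_sub, PowerSeries.coeff_map, coeff_hSeries b, map_sum, map_sum, sub_eq_zero]
    simp only [evalAt_smul, PowerSeries.coeff_C_mul]
    rw [← sum_subset (range_mono (Nat.succ_le_of_lt hd))]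
    · exact sum_congr rfl fun k _ => mul_comm _ _
    · intro k _ hk
      rw [coeff_recipSeries_of_lt _ (by simpa using hk), mul_zero]
  have h1 : genFun x y = (∑ k ∈ range (N + 1),
      toL (Polynomial.C (evalAt x y (hNat b k))) * (facZ b k)⁻¹) +
      HahnSeries.single (1 : ℤ) (1 : ℂ) ^ (N + 1) * (g : LaurentSeries ℂ) := by
    have h := congrArg (HahnSeries.ofPowerSeries ℤ ℂ) (sub_eq_iff_eq_add'.1 hg)
    rw [coe_map_hSeries, map_add, map_sum, map_mul, map_pow, PowerSeries.coe_X] at h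
    rw [h]
    congr 1
    refine sum_congr rfl fun k _ => ?_
    rw [map_mul, coe_recipSeries, toL_C, PowerSeries.coe_C]
  -- The tail has order at least `(N + 1) - (m - 1) ≥ 2` in `t`, as `N ≥ m`.
  have h2 : res (facZ b (m - 1) * (HahnSeries.single (1 : ℤ) (1 : ℂ) ^ (N + 1) *
      (g : LaurentSeries ℂ))) = 0 := by
    rw [← mul_assoc]
    refine MonicOrder.res_mul ((monicOrder_facZ b (m - 1)).mul (w := N + 1) ⟨1, by simp, ?_⟩) ?_ g
    · rw [← RatFunc.single_one_eq_pow]; simp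
    · omega
  have h3 : ∀ k : ℕ, res (facZ b (m - 1) *
      (toL (Polynomial.C (evalAt x y (hNat b k))) * (facZ b k)⁻¹)) =
      if (k : ℤ) = m then evalAt x y (hNat b k) else 0 := by
    intro k
    have h4 := facZ_add b k (m - 1 - k)
    rw [sub_add_cancel] at h4
    rw [mul_left_comm, res_C_mul, h4, mul_comm (facZ b k), mul_inv_cancel_right₀
      (monicOrder_facZ b k).ne_zero, res_facZ]
    have : m - 1 - k = -1 ↔ (k : ℤ) = m := by omega
    simp only [this, mul_ite, mul_one, mul_zero]
  rw [h1, mul_add, map_add, h2, add_zero, mul_sum, map_sum, hInt]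
  simp only [h3]
  split_ifs with hm
  · rw [map_zero, sum_eq_zero]
    intro k _
    rw [if_neg (by omega)]
  · rw [sum_eq_single N]
    · rw [if_pos (by omega)]
    · intro k _ hk
      rw [if_neg (by omega)]
    · simp

/-- The shifts are chosen so that `(u|τ^{-j}a)^{z+j} = (u|τ^{-j}a)^j (u|a)^z`: the row factor no
longer depends on the column, and the column factor is monic of degree `j`, hence replaceable by
`u^j`. -/
theorem evalAt_jacobiTrudiDet {n : ℕ} (x y : Fin n → ℂ) (μ : YoungDiagram) (a : ℤ → ℂ) (N : ℕ) :
    evalAt x y (jacobiTrudiDet μ a N) = schurDet N μ a (genFun x y) := by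
  rw [jacobiTrudiDet, RingHom.map_det, schurDet, resDet,
    ← det_functional_monic (fun i : Fin N => resFun (facZ a ((μ.rowLen i : ℤ) - i - 1))
      (genFun x y)) (fun j : Fin N => facPoly (shift (-(j : ℤ)) a) j)
      (fun j => natDegree_facPoly _ _) (fun j => facPoly_monic _ _)]
  congr 1
  ext i j
  rw [RingHom.mapMatrix_apply, Matrix.map_apply, Matrix.of_apply, Matrix.of_apply, evalAt_hInt,
    resFun_apply]
  have h := facZ_add (shift (-(j : ℤ)) a) j ((μ.rowLen i : ℤ) - i - 1)
  have h1 : shift (j : ℤ) (shift (-(j : ℤ)) a) = a := by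
    funext k
    simp [shift]
  rw [h1, facZ_natCast] at h
  rw [show (μ.rowLen i : ℤ) - i + j - 1 = (μ.rowLen i : ℤ) - i - 1 + j by ring, h]
  congr 1
  ring

/-! ### The induction at generic points and the return to polynomials. -/

theorem lt_depth_iff (μ : YoungDiagram) (i : ℕ) : i < depth μ ↔ (i, i) ∈ μ := by
  have hex : ∃ i, (i, i) ∉ μ := ⟨μ.rowLen 0, fun h => by
    have h1 := YoungDiagram.mem_iff_lt_rowLen.1 h
    have h2 := μ.rowLen_anti _ _ (Nat.zero_le (μ.rowLen 0))
    omega⟩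
  classical
  have hiff : ∀ j, (j, j) ∈ μ ↔ j < Nat.find hex := fun j => by
    constructor
    · intro h
      by_contra hj
      exact Nat.find_spec hex (μ.up_left_mem (not_lt.1 hj) (not_lt.1 hj) h)
    · intro h
      exact not_not.1 (Nat.find_min hex h)
  have hd : depth μ = Nat.find hex := by
    rw [depth, ← card_range (Nat.find hex),
      ← card_image_of_injective (range _) (f := fun i : ℕ => (i, i)) fun i j h => (Prod.mk.inj h).1]
    congr 1
    ext ⟨j, k⟩
    simp only [mem_filter, YoungDiagram.mem_cells, mem_image, mem_range, Prod.mk.injEq, ← hiff]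
    constructor
    · rintro ⟨h, rfl⟩
      exact ⟨j, h, rfl, rfl⟩
    · rintro ⟨i, h, rfl, rfl⟩
      exact ⟨h, rfl⟩
  rw [hd, hiff]

/-- The factors `(x | a)^{μ_i - i}` as polynomials in one variable. -/
def rowPoly (μ : YoungDiagram) (a : ℤ → ℂ) (i : ℕ) : Polynomial ℂ :=
  facPoly a (μ.rowLen i - (i + 1))

theorem degBound_rowPoly (μ : YoungDiagram) (a : ℤ → ℂ) : DegBound μ (rowPoly μ a) :=
  fun _ => (natDegree_facPoly _ _).le

theorem rowPoly_removeHook (μ : YoungDiagram) (a : ℤ → ℂ) :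
    (fun i => rowPoly μ a (i + 1)) = rowPoly (removeHook μ) a := by
  funext i
  rw [rowPoly, rowPoly, rowLen_removeHook]
  congr 1
  omega

theorem evalAt_multiSchur {n : ℕ} (x y : Fin n → ℂ) (μ : YoungDiagram) (a : ℤ → ℂ) {N : ℕ}
    (hN : μ.colLen 0 ≤ N) : evalAt x y (multiSchur μ a) = schurDet N μ a (genFun x y) := by
  rw [← jacobiTrudiDet_eq_multiSchur μ a N hN, evalAt_jacobiTrudiDet]

theorem genFun_cancel_right {n : ℕ} (x : Fin (n + 1) → ℂ) (y : Fin n → ℂ) (k : Fin (n + 1)) :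
    genFun x (Fin.cons (-x k) y : Fin (n + 1) → ℂ) = genFun (x ∘ k.succAbove) y := by
  rw [← genFun_succAbove_left, genFun, genFun, Fin.prod_univ_succ]
  simp only [Fin.cons_zero, Fin.cons_succ, neg_neg, mul_assoc]

theorem cons_comp_succ {n : ℕ} (z : Fin (n + 1) → ℂ) :
    (Fin.cons (z 0) (z ∘ Fin.succ) : Fin (n + 1) → ℂ) = z := Fin.cons_self_tail z

/-- The two expansions of the determinant give the double sum of `altVal_succ` term by term;
`vd_succAbove` accounts for the signs and denominators. The order `M` left after deleting a row may
exceed the number of rows of the smaller diagram, which does not change the determinant. -/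
theorem evalAt_multiSchur_mul_vd_of_large {n : ℕ} (μ : YoungDiagram) (a : ℤ → ℂ)
    (hrow : n < μ.rowLen 0) (hcol : n < μ.colLen 0) {x y : Fin (n + 1) → ℂ} (h : Generic x y)
    (ih : ∀ x y : Fin n → ℂ, Generic x y →
      evalAt x y (multiSchur (removeHook μ) a) * (vd x * vd y) =
        altVal (removeHook μ) (rowPoly (removeHook μ) a)
          (rowPoly (removeHook μ).transpose (dualSeq a)) x y) :
    evalAt x y (multiSchur μ a) * (vd x * vd y) =
      altVal μ (rowPoly μ a) (rowPoly μ.transpose (dualSeq a)) x y := by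
  obtain ⟨M, hM⟩ := Nat.exists_eq_succ_of_ne_zero (show μ.colLen 0 ≠ 0 by omega)
  have hM' : (removeHook μ).colLen 0 ≤ M := by
    rw [colLen_removeHook]
    have := μ.colLen_anti _ _ (Nat.zero_le 1)
    simp only [zero_add]
    omega
  rw [evalAt_multiSchur x y μ a hM.le, schurDet_expand_row μ a hM h, altVal_succ _ _ _ hrow hcol,
    sum_mul]
  refine sum_congr rfl fun k _ => ?_
  rw [schurDet_expand_zeros _ a (h.comp_left k.succAbove_right_injective), mul_sum, sum_mul]
  refine sum_congr rfl fun l _ => ?_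
  have hx : ∏ i, (x k - x (k.succAbove i)) ≠ 0 := prod_ne_zero_iff.2 fun i _ =>
    sub_ne_zero.2 (h.1.ne (Fin.succAbove_ne k i).symm)
  have hy : ∏ i, (y l - y (l.succAbove i)) ≠ 0 := prod_ne_zero_iff.2 fun i _ =>
    sub_ne_zero.2 (h.2.ne (Fin.succAbove_ne l i).symm)
  have h1 := ih (x ∘ k.succAbove) (y ∘ l.succAbove)
    (h.comp k.succAbove_right_injective l.succAbove_right_injective)
  rw [rowPoly_removeHook, rowPoly_removeHook, ← transpose_removeHook, ← h1,
    evalAt_multiSchur _ _ _ a hM', vd_succAbove k x, vd_succAbove l y]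
  have h2 : rowPoly μ a 0 = facPoly a (μ.rowLen 0 - 1) := rfl
  have h3 : rowPoly μ.transpose (dualSeq a) 0 = facPoly (dualSeq a) M := by
    rw [rowPoly, YoungDiagram.rowLen_transpose, hM]; rfl
  rw [h2, h3]
  simp only [Function.comp_apply]
  field_simp

theorem evalAt_multiSchur_mul_vd {n : ℕ} (μ : YoungDiagram) (a : ℤ → ℂ) (hμ : (n, n) ∉ μ)
    {x y : Fin n → ℂ} (h : Generic x y) :
    evalAt x y (multiSchur μ a) * (vd x * vd y) =
      altVal μ (rowPoly μ a) (rowPoly μ.transpose (dualSeq a)) x y := by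
  induction n generalizing μ with
  | zero =>
    have h0 : μ.colLen 0 = 0 := by
      rw [YoungDiagram.mem_iff_lt_colLen] at hμ; omega
    rw [evalAt_multiSchur x y μ a h0.le, schurDet, resDet, Matrix.det_fin_zero]
    simp [vd, altVal, alt, fVal]
  | succ n ih =>
    rcases le_or_gt (μ.rowLen 0) n with hrow | hrow
    · have hn : (n, n) ∉ μ := fun h' => by
        have h1 := YoungDiagram.mem_iff_lt_rowLen.1 h'
        have h2 := μ.rowLen_anti _ _ (Nat.zero_le n)
        omega
      have key := altVal_eq_of_values μ _ _ (degBound_rowPoly μ a)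
        (degBound_rowPoly μ.transpose (dualSeq a)) hrow
        (h.comp_left (Fin.succ_injective n))
        (polyLE_schurDet_left (μ.colLen 0) μ a (x ∘ Fin.succ) y) (fun j => ?_) (x 0)
      · rw [cons_comp_succ] at key
        rw [evalAt_multiSchur x y μ a le_rfl, key]
      · rw [genFun_cancel, ← evalAt_multiSchur _ _ μ a le_rfl]
        exact ih μ hn (h.comp (Fin.succ_injective n) j.succAbove_right_injective)
    · rcases le_or_gt (μ.colLen 0) n with hcol | hcol
      · have hn : (n, n) ∉ μ := fun h' => by
          have h1 := YoungDiagram.mem_iff_lt_colLen.1 h'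
          have h2 := μ.colLen_anti _ _ (Nat.zero_le n)
          omega
        -- Only the numerator is transposed. The determinant stays that of `μ`, and its degree in
        -- the first `y` is at most its order, the length of the first column.
        have key := altVal_eq_of_values μ.transpose _ (rowPoly μ a)
          (degBound_rowPoly μ.transpose (dualSeq a))
          (by rw [YoungDiagram.transpose_transpose]; exact degBound_rowPoly μ a)
          (by rwa [YoungDiagram.rowLen_transpose])
          (h.symm.comp_left (Fin.succ_injective n))
          (s := fun t => schurDet (μ.colLen 0) μ a
            (genFun x (Fin.cons t (y ∘ Fin.succ) : Fin (n + 1) → ℂ)))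
          (by rw [YoungDiagram.rowLen_transpose]
              exact polyLE_schurDet_right (μ.colLen 0) μ a x (y ∘ Fin.succ)) (fun j => ?_) (y 0)
        · rw [cons_comp_succ, altVal_transpose] at key
          rw [evalAt_multiSchur x y μ a le_rfl, ← key, mul_comm (vd x)]
        · rw [genFun_cancel_right, ← evalAt_multiSchur _ _ μ a le_rfl, altVal_transpose,
            mul_comm (vd _)]
          exact ih μ hn (h.comp j.succAbove_right_injective (Fin.succ_injective n))
      · exact evalAt_multiSchur_mul_vd_of_large μ a hrow hcol h fun x y hxy =>
          ih (removeHook μ) (by rwa [mem_removeHook]) hxy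

theorem eval_vand {n : ℕ} (z : Fin n ⊕ Fin n → ℂ) (v : Fin n → Poly n) :
    MvPolynomial.eval z (vand v) = vd fun i => MvPolynomial.eval z (v i) := by
  simp [vand, vd, map_prod]

theorem eval_facPow {n : ℕ} (z : Fin n ⊕ Fin n → ℂ) (x : Poly n) (a : ℤ → ℂ) (m : ℕ) :
    MvPolynomial.eval z (facPow x a m) = (facPoly a m).eval (MvPolynomial.eval z x) := by
  simp [facPow, facPoly, map_prod, Polynomial.eval_prod]

theorem eval_fPoly {n : ℕ} (x y : Fin n → ℂ) (μ : YoungDiagram) (a : ℤ → ℂ) :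
    MvPolynomial.eval (Sum.elim x y) (fPoly n μ a) =
      fVal μ (rowPoly μ a) (rowPoly μ.transpose (dualSeq a)) x y := by
  rw [fPoly, fVal, map_mul, map_mul, map_prod, map_prod, map_prod]
  congr 1
  · rw [prod_filter, prod_filter, ← prod_mul_distrib, ← prod_mul_distrib]
    refine prod_congr rfl fun i _ => ?_
    by_cases h : ((i : ℕ), (i : ℕ)) ∈ μ
    · have h1 := (lt_depth_iff μ i).2 h
      rw [if_pos h1, if_neg (not_le.2 h1)]
      simp [weight, h, eval_facPow, rowPoly, xv, yv]
    · have h1 := mt (lt_depth_iff μ i).1 h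
      rw [if_neg h1, if_pos (not_lt.1 h1)]
      simp [weight, h, xv, yv]
  · simp [xv, yv]

theorem eval_antisymm_fPoly {n : ℕ} (x y : Fin n → ℂ) (μ : YoungDiagram) (a : ℤ → ℂ) :
    MvPolynomial.eval (Sum.elim x y) (antisymm (fPoly n μ a)) =
      altVal μ (rowPoly μ a) (rowPoly μ.transpose (dualSeq a)) x y := by
  rw [antisymm, map_sum, Fintype.sum_prod_type]
  simp only [altVal, alt, mul_sum]
  refine sum_congr rfl fun w _ => sum_congr rfl fun v _ => ?_
  rw [map_zsmul, permAct, MvPolynomial.eval_rename, Sum.elim_comp_map, eval_fPoly, zsmul_eq_mul]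
  push_cast
  ring

theorem injective_of_vd_ne_zero {n : ℕ} {v : Fin n → ℂ} (h : vd v ≠ 0) :
    Function.Injective v := by
  rw [vd_eq_det, Matrix.det_vandermonde_ne_zero_iff] at h
  intro i j hij
  exact h (by simp [hij])

/-- The nonzero polynomial `g` collects all conditions of genericity. After multiplication by `g`
the identity is trivial at the zeros of `g`, and every other point is generic. -/
theorem superEval_multiSchur_mul_vand (a : ℤ → ℂ) (n : ℕ) (μ : YoungDiagram)
    (hμ : depth μ ≤ n) :
    superEval n (multiSchur μ a) * (vand xv * vand yv) = antisymm (fPoly n μ a) := by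
  set g : Poly n := vand xv * vand yv * (∏ i, xv i) * (∏ i, yv i) *
    ∏ c : Fin n × Fin n, (xv c.1 + yv c.2) with hg
  have hg0 : g ≠ 0 := by
    refine mul_ne_zero (mul_ne_zero (mul_ne_zero (mul_ne_zero (vand_xv_ne_zero n)
      (vand_yv_ne_zero n)) ?_) ?_) ?_
    · exact prod_ne_zero_iff.2 fun i _ => MvPolynomial.X_ne_zero _
    · exact prod_ne_zero_iff.2 fun i _ => MvPolynomial.X_ne_zero _
    · refine prod_ne_zero_iff.2 fun c _ h0 => ?_
      have h1 := congrArg (MvPolynomial.eval (Sum.elim (fun _ => (1 : ℂ)) fun _ => 0)) h0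
      simp [xv, yv] at h1
  refine mul_right_cancel₀ hg0 (MvPolynomial.funext fun z => ?_)
  obtain ⟨x, y, rfl⟩ : ∃ x y : Fin n → ℂ, z = Sum.elim x y :=
    ⟨z ∘ Sum.inl, z ∘ Sum.inr, (Sum.elim_comp_inl_inr z).symm⟩
  rw [map_mul, map_mul _ (antisymm _)]
  by_cases hz : MvPolynomial.eval (Sum.elim x y) g = 0
  · rw [hz, mul_zero, mul_zero]
  congr 1
  have hx : (fun i => MvPolynomial.eval (Sum.elim x y) (xv i)) = x := by
    funext i; simp [xv]
  have hy : (fun i => MvPolynomial.eval (Sum.elim x y) (yv i)) = y := by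
    funext i; simp [yv]
  have hgen : Generic x y := by
    rw [hg] at hz
    simp only [map_mul, eval_vand, hx, hy, map_prod, mul_eq_zero, not_or, prod_eq_zero_iff,
      not_exists, mem_univ, true_and, map_add] at hz
    obtain ⟨⟨⟨⟨h1, h2⟩, h3⟩, h4⟩, h5⟩ := hz
    refine ⟨injective_of_vd_ne_zero h1, injective_of_vd_ne_zero h2, fun i => ?_, fun i => ?_,
      fun i j => ?_⟩
    · simpa [xv] using h3 i
    · simpa [yv] using h4 i
    · simpa [xv, yv] using h5 (i, j)
  have hn : (n, n) ∉ μ := fun h => by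
    have := (lt_depth_iff μ n).2 h
    omega
  rw [map_mul, map_mul, eval_vand, eval_vand, hx, hy, eval_antisymm_fPoly]
  exact evalAt_multiSchur_mul_vd μ a hn hgen

end

end MultiSchur

end

/-- The quotient is taken in the field of rational functions in `x₁, …, x_n, y₁, …, y_n`; the
denominator is nonzero by `vand_xv_ne_zero` and `vand_yv_ne_zero`. -/
theorem theorem6p1 (a : ℤ → ℂ) (n : ℕ) (hn : 1 ≤ n) (μ : YoungDiagram)
    (hμ : MultiSchur.depth μ ≤ n) :
    algebraMap (MultiSchur.Poly n) (FractionRing (MultiSchur.Poly n))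
        (MultiSchur.superEval n (MultiSchur.multiSchur μ a)) =
      algebraMap (MultiSchur.Poly n) (FractionRing (MultiSchur.Poly n))
          (MultiSchur.antisymm (MultiSchur.fPoly n μ a)) /
        (algebraMap (MultiSchur.Poly n) (FractionRing (MultiSchur.Poly n))
            (MultiSchur.vand MultiSchur.xv) *
          algebraMap (MultiSchur.Poly n) (FractionRing (MultiSchur.Poly n))
            (MultiSchur.vand MultiSchur.yv)) := by
  have hinj := IsFractionRing.injective (MultiSchur.Poly n) (FractionRing (MultiSchur.Poly n))
  have hx := (map_ne_zero_iff _ hinj).2 (MultiSchur.vand_xv_ne_zero n)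
  have hy := (map_ne_zero_iff _ hinj).2 (MultiSchur.vand_yv_ne_zero n)
  rw [eq_div_iff (mul_ne_zero hx hy), ← map_mul, ← map_mul,
    MultiSchur.superEval_multiSchur_mul_vand a n μ hμ]
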